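/- Let $d\ge 0$, $n\ge 0$, let $X_1,\dots,X_n$ be square-integrable random vectors in $\mathbb R^d$ that form a martingale difference sequence for a filtration $\mathcal F_0\subseteq\mathcal F_1\subseteq\dots\subseteq\mathcal F_n$ (that is, $X_k$ is $\mathcal F_k$-measurable and $E[X_k\mid\mathcal F_{k-1}]=0$ almost surely), and let $V_k=E[X_kX_k^{\top}\mid\mathcal F_{k-1}]$ almost surely for $1\le k\le n$. Put $S_n=\sum_{i=1}^n X_i$, $P_k=\sum_{i=k}^n V_i$ and $\Sigma=\mathrm{Var}(S_n)$ (the covariance matrix). Assume that $\Sigma$ is positive definite and that $P_1=\Sigma$ almost surely. Let $Z\sim N(0,I)$ be a standard normal vector in $\mathbb R^d$, let $h:\mathbb R^d\to\mathbb R$ be twice differentiable, and let $$M_2(h)=\sup_{x\ne y}\frac{\|\nabla h(x)-\nabla h(y)\|_2}{\|x-y\|_2}\in[0,\infty].$$ If $M_2(h)<\infty$, then $h(\Sigma^{-1/2}S_n)$ and $h(Z)$ are integrable and $$\bigl|E\,h(\Sigma^{-1/2}S_n)-E\,h(Z)\bigr|\le\frac{3\pi}{8}\sqrt d\,M_2(h)\sum_{k=1}^n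 E\Bigl[\bigl\|\Sigma^{1/2}P_k^{-1}\Sigma^{1/2}\bigr\|_2^{1/2}\,\bigl\|\Sigma^{-1/2}X_k\bigr\|_2^3\Bigr];$$ if $M_2(h)=\infty$ the right-hand side is infinite when $d\ge1$, and the bound holds trivially. Here $\|\cdot\|_2$ is the Euclidean norm of a vector and the corresponding operator norm of a matrix, $\|\Sigma^{1/2}P_k^{-1}\Sigma^{1/2}\|_2$ is read as $\infty$ at points where $P_k$ is singular, the expectations on the right take values in $[0,\infty]$, and $0\cdot\infty=0$. -/

import Mathlib

open MeasureTheory ProbabilityTheory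
open scoped ENNReal MatrixOrder

noncomputable section

namespace MartingaleCLT

/-- `X 1, …, X n` is a martingale difference sequence with respect to `ℱ 0 ⊆ ℱ 1 ⊆ ⋯ ⊆ ℱ n`.
Only the indices `1, …, n` of `X` and `0, …, n` of `ℱ` are used. -/
structure IsMartingaleDifference {Ω : Type*} {m : MeasurableSpace Ω} {d : ℕ}
    (n : ℕ) (X : ℕ → Ω → EuclideanSpace ℝ (Fin d)) (ℱ : Filtration ℕ m) (μ : Measure Ω) :
    Prop where
  adapted : ∀ k ∈ Finset.Icc 1 n, StronglyMeasurable[ℱ k] (X k)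
  integrable : ∀ k ∈ Finset.Icc 1 n, Integrable (X k) μ
  condExp_eq_zero : ∀ k ∈ Finset.Icc 1 n, μ[X k | ℱ (k - 1)] =ᵐ[μ] 0

/-- `V` is a version of the conditional expectation `E[Y Yᵀ | 𝒢]` of the random matrix `Y Yᵀ`
(taken entry by entry). -/
def IsCondSecondMoment {Ω : Type*} (𝒢 : MeasurableSpace Ω) {m : MeasurableSpace Ω} {d : ℕ}
    (V : Ω → Matrix (Fin d) (Fin d) ℝ) (Y : Ω → EuclideanSpace ℝ (Fin d))
    (μ : Measure Ω) : Prop :=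
  ∀ i j, (fun ω => V ω i j) =ᵐ[μ] μ[fun ω => Y ω i * Y ω j | 𝒢]

/-- The sum `S_n = X_1 + ⋯ + X_n`. -/
def partialSum {Ω : Type*} {d : ℕ} (n : ℕ) (X : ℕ → Ω → EuclideanSpace ℝ (Fin d)) (ω : Ω) :
    EuclideanSpace ℝ (Fin d) :=
  ∑ k ∈ Finset.Icc 1 n, X k ω

/-- The partial covariance `P_k = V_k + ⋯ + V_n`. -/
def partialCov {Ω : Type*} {d : ℕ} (n : ℕ) (V : ℕ → Ω → Matrix (Fin d) (Fin d) ℝ) (k : ℕ)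
    (ω : Ω) : Matrix (Fin d) (Fin d) ℝ :=
  ∑ i ∈ Finset.Icc k n, V i ω

/-- The variance (covariance matrix) of a random vector. -/
def varMatrix {Ω : Type*} {m : MeasurableSpace Ω} {d : ℕ} (Y : Ω → EuclideanSpace ℝ (Fin d))
    (μ : Measure Ω) : Matrix (Fin d) (Fin d) ℝ :=
  Matrix.of fun i j => cov[fun ω => Y ω i, fun ω => Y ω j; μ]

/-- The operator norm of a matrix with respect to the Euclidean norm. -/
def opNorm {d : ℕ} (A : Matrix (Fin d) (Fin d) ℝ) : ℝ :=
  ‖Matrix.toEuclideanCLM (𝕜 := ℝ) A‖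

/-- The vector `S^{-1/2} x`, for a positive definite matrix `S`. -/
def invSqrtMul {d : ℕ} (S : Matrix (Fin d) (Fin d) ℝ) (x : EuclideanSpace ℝ (Fin d)) :
    EuclideanSpace ℝ (Fin d) :=
  Matrix.toEuclideanCLM (𝕜 := ℝ) (CFC.sqrt S)⁻¹ x

open Classical in
/-- The norm `‖S^{1/2} P⁻¹ S^{1/2}‖₂`, which is `∞` if `P` is singular. -/
def relInvNorm {d : ℕ} (S P : Matrix (Fin d) (Fin d) ℝ) : ℝ≥0∞ :=
  if IsUnit P.det then ENNReal.ofReal (opNorm (CFC.sqrt S * P⁻¹ * CFC.sqrt S)) else ∞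

/-- `M₂(h)`: the smallest Lipschitz constant of the gradient of `h`, possibly `∞`. -/
def M₂ {d : ℕ} (h : EuclideanSpace ℝ (Fin d) → ℝ) : ℝ≥0∞ :=
  ⨆ (x) (y) (_ : x ≠ y), ENNReal.ofReal (‖gradient h x - gradient h y‖ / ‖x - y‖)

end MartingaleCLT

end

/-!
After replacing `X k` by `Σ^{-1/2} X k` the total conditional covariance is the identity matrix. The
differences are then exchanged for Gaussian vectors one at a time: `T k` is the mean of
`h(S_k + P_{k+1}^{1/2} Z)`, with `Z` standard normal and independent of the martingale, so that
`T n` and `T 0` are the two expectations to be compared. Since `P_{k+1} = 1 - (V_1 + ⋯ + V_k)` is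
known at time `k - 1` (`remainingCov`), the difference `T k - T (k - 1)` can be estimated
conditionally on `ℱ (k - 1)`. This leaves a statement about a single centred law `ν` with covariance
`P - Q`: if `X` has law `ν` and `Z`, `Z'` are independent standard normal vectors, compare
`h(s + X + Q^{1/2} Z')` with `h(s + P^{1/2} Z)` (`abs_integral_sub_integral_gaussian_le`).

The two vectors are joined by the rotation path
`W_θ = s + sin θ (X + Q^{1/2} Z') + cos θ P^{1/2} Z`. In the derivative of `E h(W_θ)` one integrates
by parts in `Z` and `Z'`. Because the covariances match, the result is
`cos θ (E ⟨∇h(W_θ), X⟩ - sin θ E ⟨D²h(W_θ) Y, Y⟩)`, with `Y` an independent copy of `X`. Expand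
both expectations around `X = 0`: the constant term `⟨∇h, X⟩` vanishes because `X` is centred, and
the terms with `D²h` cancel. What remains is controlled by the modulus of continuity of the Hessian
of `h` smoothed by the Gaussian vector `cos θ P^{1/2} Z`. This smoothed Hessian is Lipschitz although `D²h` is only bounded by `M₂(h)`: a
translation by `a` of the standard normal law has `L¹` distance at most `‖a‖` from it
(`integral_abs_gaussDensity_sub_le`, by the Hellinger distance), so that the Lipschitz constant is
at most `M₂(h) ‖P^{-1/2}‖ / cos θ` (`abs_smoothQuad_sub_le`). The factor `cos θ` cancels, and the
derivative is bounded by `(3/2) sin² θ M₂(h) ‖P^{-1/2}‖ E ‖X‖³`; integrating over `[0, π/2]` gives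
the constant `3π/8`. No factor `√d` arises; for `d ≥ 1` it only increases the bound.

Degenerate cases: where `P` is singular, the bound is infinite unless the increment vanishes, in
which case `P = Q` and nothing changes. If `M₂(h) = 0`, which includes `d = 0`, then `h` is affine and
both expectations are `h(0)`. If `M₂(h) = ∞` and `d ≥ 1`, the right-hand side is infinite because
the sum of third moments is not zero (`sum_lintegral_ne_zero`).
-/

namespace MartingaleCLT

/-! ### The standard Gaussian density, integration by parts and translations -/

section Gaussian

variable {E : Type*} [NormedAddCommGroup E] [InnerProductSpace ℝ E]

/-- The density `(2π)^{-dim/2} exp(-‖x‖²/2)` of the standard Gaussian measure. -/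
noncomputable def gaussDensity (x : E) : ℝ :=
  (2 * Real.pi) ^ (-(Module.finrank ℝ E / 2 : ℝ)) * Real.exp (-‖x‖ ^ 2 / 2)

lemma gaussDensity_pos (x : E) : 0 < gaussDensity x := by
  unfold gaussDensity; positivity

lemma continuous_gaussDensity : Continuous (gaussDensity (E := E)) := by
  unfold gaussDensity; fun_prop

variable [FiniteDimensional ℝ E] [MeasurableSpace E] [BorelSpace E]

lemma integral_gaussDensity : ∫ x : E, gaussDensity x = 1 := by
  have h := GaussianFourier.integral_rexp_neg_mul_sq_norm (V := E) (b := 1 / 2) (by norm_num)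
  simp only [gaussDensity]
  rw [integral_const_mul]
  have e : (fun x : E => Real.exp (-‖x‖ ^ 2 / 2)) = fun x : E => Real.exp (-(1 / 2) * ‖x‖ ^ 2) := by
    ext x; ring_nf
  rw [e, h, show Real.pi / (1 / 2) = 2 * Real.pi by ring, ← Real.rpow_add (by positivity)]
  simp

lemma integrable_gaussDensity : Integrable (gaussDensity (E := E)) :=
  Integrable.of_integral_ne_zero (by rw [integral_gaussDensity]; norm_num)

lemma stdGaussian_eq_withDensity :
    stdGaussian E = volume.withDensity (fun x => ENNReal.ofReal (gaussDensity x)) := by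
  have hm : Measurable (fun x : E => ENNReal.ofReal (gaussDensity x)) :=
    continuous_gaussDensity.measurable.ennreal_ofReal
  have : IsFiniteMeasure (volume.withDensity (fun x : E => ENNReal.ofReal (gaussDensity x))) := by
    refine ⟨?_⟩
    rw [withDensity_apply _ MeasurableSet.univ, Measure.restrict_univ,
      ← ofReal_integral_eq_lintegral_ofReal integrable_gaussDensity
        (.of_forall fun x => (gaussDensity_pos x).le)]
    exact ENNReal.ofReal_lt_top
  refine Measure.ext_of_charFun (funext fun t => ?_)
  rw [charFun_stdGaussian, charFun_apply,
    integral_withDensity_eq_integral_toReal_smul hm (by simp)]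
  have h := GaussianFourier.integral_cexp_neg_mul_sq_norm_add (V := E) (b := 1 / 2)
    (by norm_num) Complex.I t
  have e : (fun x : E => (ENNReal.ofReal (gaussDensity x)).toReal •
      Complex.exp ((inner ℝ x t : ℝ) * Complex.I)) = fun x : E =>
      (((2 * Real.pi) ^ (-(Module.finrank ℝ E / 2 : ℝ)) : ℝ) : ℂ) *
        Complex.exp (-(1 / 2) * (‖x‖ : ℂ) ^ 2 + Complex.I * (inner ℝ t x : ℝ)) := by
    ext x
    rw [ENNReal.toReal_ofReal (gaussDensity_pos x).le, gaussDensity, Complex.real_smul,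
      Complex.ofReal_mul, mul_assoc, Complex.ofReal_exp, ← Complex.exp_add, real_inner_comm]
    congr 2
    push_cast
    ring
  rw [e, integral_const_mul, h, ← mul_assoc]
  have e2 : ((Real.pi : ℂ) / (1 / 2)) ^ ((Module.finrank ℝ E : ℂ) / 2) =
      (((2 * Real.pi) ^ (Module.finrank ℝ E / 2 : ℝ) : ℝ) : ℂ) := by
    rw [Complex.ofReal_cpow (by positivity)]
    push_cast
    congr 1; ring
  rw [e2, ← Complex.ofReal_mul, ← Real.rpow_add (by positivity)]
  simp only [neg_add_cancel, Real.rpow_zero, Complex.ofReal_one, one_mul, Complex.I_sq]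
  congr 1; ring

lemma integral_stdGaussian {F : Type*} [NormedAddCommGroup F] [NormedSpace ℝ F] (f : E → F) :
    ∫ x, f x ∂(stdGaussian E) = ∫ x, gaussDensity x • f x := by
  rw [stdGaussian_eq_withDensity, integral_withDensity_eq_integral_toReal_smul
    continuous_gaussDensity.measurable.ennreal_ofReal (by simp)]
  simp only [ENNReal.toReal_ofReal (gaussDensity_pos _).le]

lemma integrable_stdGaussian_iff {F : Type*} [NormedAddCommGroup F] [NormedSpace ℝ F] {f : E → F} :
    Integrable f (stdGaussian E) ↔ Integrable (fun x => gaussDensity x • f x) := by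
  rw [stdGaussian_eq_withDensity, integrable_withDensity_iff_integrable_smul'
    continuous_gaussDensity.measurable.ennreal_ofReal (by simp)]
  simp only [ENNReal.toReal_ofReal (gaussDensity_pos _).le]

/-- Gaussian integration by parts (Stein's identity) in the direction `v`. -/
lemma integral_inner_mul_stdGaussian {f : E → ℝ} {f' : E → ℝ} (v : E)
    (hf : ∀ x, HasLineDerivAt ℝ f (f' x) x v) (hfi : Integrable f (stdGaussian E))
    (hfv : Integrable (fun x => inner ℝ v x * f x) (stdGaussian E))
    (hf'i : Integrable f' (stdGaussian E)) :
    ∫ x, inner ℝ v x * f x ∂(stdGaussian E) = ∫ x, f' x ∂(stdGaussian E) := by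
  rw [integrable_stdGaussian_iff] at hfi hfv hf'i
  rw [integral_stdGaussian, integral_stdGaussian]
  simp only [smul_eq_mul] at *
  have hd : ∀ x : E, HasLineDerivAt ℝ (gaussDensity (E := E))
      (-(inner ℝ v x) * gaussDensity x) x v := by
    intro x
    have h1 : HasFDerivAt (fun y : E => ‖y‖ ^ 2) (2 • innerSL ℝ x) x :=
      (hasStrictFDerivAt_norm_sq x).hasFDerivAt
    have h2 := (((h1.neg.mul_const (2⁻¹ : ℝ)).exp.const_mul
      ((2 * Real.pi) ^ (-(Module.finrank ℝ E / 2 : ℝ)))).hasLineDerivAt v)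
    refine h2.congr_deriv ?_ |>.congr_of_eventuallyEq ?_
    · simp [gaussDensity, real_inner_comm]
      ring_nf
    · filter_upwards with y
      simp only [gaussDensity, Pi.neg_apply]
      ring_nf
  have := integral_bilinear_hasLineDerivAt_right_eq_neg_left_of_integrable (μ := volume)
    (B := ContinuousLinearMap.mul ℝ ℝ) (f := gaussDensity (E := E)) (g := f) (v := v)
    (f' := fun x => -(inner ℝ v x) * gaussDensity x) (g' := f')
    (by simp only [ContinuousLinearMap.mul_apply']
        refine hfv.neg.congr (.of_forall fun x => ?_)
        simp; ring)
    hf'i hfi (fun x _ => hd x) (fun x _ => hf x)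
  simp only [ContinuousLinearMap.mul_apply'] at this
  rw [this, ← integral_neg]
  congr 1; ext x; ring

/-- The total variation distance between a standard Gaussian measure and its translate: the overlap
of the square roots of the two densities is `exp(-‖a‖²/8)`, and Cauchy--Schwarz turns this
Hellinger bound into an `L¹` bound. -/
lemma integral_abs_gaussDensity_sub_le (a : E) :
    ∫ x : E, |gaussDensity (x - a) - gaussDensity x| ≤ ‖a‖ := by
  set p : E → ℝ := gaussDensity
  set f : E → ℝ := fun x => √(p (x - a))
  set g : E → ℝ := fun x => √(p x)
  have hp : ∀ x, 0 < p x := gaussDensity_pos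
  have hpc : Continuous p := continuous_gaussDensity
  have hpi : Integrable p := integrable_gaussDensity
  have hpa : Integrable (fun x => p (x - a)) := hpi.comp_sub_right a
  have hfc : Continuous f := by fun_prop
  have hgc : Continuous g := by fun_prop
  have hff : ∀ x, f x * f x = p (x - a) := fun x => Real.mul_self_sqrt (hp _).le
  have hgg : ∀ x, g x * g x = p x := fun x => Real.mul_self_sqrt (hp _).le
  have hfg : ∀ x, f x * g x = Real.exp (-‖a‖ ^ 2 / 8) * p (x - (2⁻¹ : ℝ) • a) := by
    intro x
    have e1 : p (x - a) * p x = (Real.exp (-‖a‖ ^ 2 / 8) * p (x - (2⁻¹ : ℝ) • a)) ^ 2 := by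
      simp only [p, gaussDensity]
      rw [mul_pow, mul_pow, ← Real.exp_nat_mul, ← Real.exp_nat_mul, mul_mul_mul_comm, ← sq,
        ← Real.exp_add, mul_left_comm, ← Real.exp_add]
      congr 2
      rw [norm_sub_sq_real, norm_sub_sq_real, norm_smul, inner_smul_right]
      norm_num
      ring
    rw [← Real.sqrt_mul (hp _).le, e1, Real.sqrt_sq]
    exact mul_nonneg (Real.exp_pos _).le (hp _).le
  have hfgi : Integrable (fun x => f x * g x) := by
    simp only [hfg]; exact (hpi.comp_sub_right _).const_mul _
  set ρ : ℝ := Real.exp (-‖a‖ ^ 2 / 8)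
  have hρ : ∫ x, f x * g x = ρ := by
    simp only [hfg]
    rw [integral_const_mul, integral_sub_right_eq_self p, integral_gaussDensity, mul_one]
  have h1 : ∫ x, p (x - a) = 1 := by rw [integral_sub_right_eq_self p, integral_gaussDensity]
  have h2 : ∫ x, p x = 1 := integral_gaussDensity
  have hsubi : Integrable (fun x => (f x - g x) ^ 2) := by
    refine ((hpa.add hpi).sub (hfgi.const_mul 2)).congr (.of_forall fun x => ?_)
    simp only [Pi.add_apply, Pi.sub_apply]
    rw [← hff, ← hgg]; ring
  have haddi : Integrable (fun x => (f x + g x) ^ 2) := by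
    refine ((hpa.add hpi).add (hfgi.const_mul 2)).congr (.of_forall fun x => ?_)
    simp only [Pi.add_apply]
    rw [← hff, ← hgg]; ring
  have hsub : ∫ x, (f x - g x) ^ 2 = 2 - 2 * ρ := by
    have : ∀ x, (f x - g x) ^ 2 = p (x - a) + p x - 2 * (f x * g x) := fun x => by
      rw [← hff, ← hgg]; ring
    simp only [this]
    rw [integral_sub (f := fun x => p (x - a) + p x) (hpa.add hpi) (hfgi.const_mul 2),
      integral_add hpa hpi, integral_const_mul,
      hρ, h1, h2]
    norm_num
  have hadd : ∫ x, (f x + g x) ^ 2 = 2 + 2 * ρ := by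
    have : ∀ x, (f x + g x) ^ 2 = p (x - a) + p x + 2 * (f x * g x) := fun x => by
      rw [← hff, ← hgg]; ring
    simp only [this]
    rw [integral_add (f := fun x => p (x - a) + p x) (hpa.add hpi) (hfgi.const_mul 2),
      integral_add hpa hpi, integral_const_mul,
      hρ, h1, h2]
    norm_num
  have habs : ∀ x, |p (x - a) - p x| = |f x - g x| * |f x + g x| := fun x => by
    rw [← abs_mul, ← hff, ← hgg]; ring_nf
  have hCS := integral_mul_le_Lp_mul_Lq_of_nonneg (μ := (volume : Measure E))
    (p := 2) (q := 2) (f := fun x => |f x - g x|) (g := fun x => |f x + g x|)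
    Real.HolderConjugate.two_two
    (.of_forall fun x => abs_nonneg _) (.of_forall fun x => abs_nonneg _)
    (by
      rw [ENNReal.ofReal_ofNat, memLp_two_iff_integrable_sq (by fun_prop)]
      simpa only [sq_abs] using hsubi)
    (by
      rw [ENNReal.ofReal_ofNat, memLp_two_iff_integrable_sq (by fun_prop)]
      simpa only [sq_abs] using haddi)
  simp only [Real.rpow_ofNat, sq_abs, hsub, hadd, ← Real.sqrt_eq_rpow] at hCS
  simp only [habs]
  have hρ1 : ρ ≤ 1 := Real.exp_le_one_iff.2 (by have := sq_nonneg ‖a‖; linarith)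
  refine hCS.trans ?_
  rw [← Real.sqrt_mul (by linarith)]
  refine Real.sqrt_le_iff.2 ⟨norm_nonneg _, ?_⟩
  have hρ2 : ρ * ρ = Real.exp (-‖a‖ ^ 2 / 4) := by
    rw [← Real.exp_add]; congr 1; ring
  have := Real.add_one_le_exp (-‖a‖ ^ 2 / 4)
  nlinarith

/-- Translating a standard Gaussian vector by `a` changes the expectation of a function bounded by
`B` by at most `B ‖a‖`. -/
lemma abs_integral_stdGaussian_add_sub_le {φ : E → ℝ} (hφ : Measurable φ) {B : ℝ}
    (hB : ∀ x, |φ x| ≤ B) (a : E) :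
    |∫ z, φ (z + a) ∂(stdGaussian E) - ∫ z, φ z ∂(stdGaussian E)| ≤ B * ‖a‖ := by
  have hpi : Integrable (gaussDensity (E := E)) := integrable_gaussDensity
  have hpa : Integrable (fun x : E => gaussDensity (x - a)) := hpi.comp_sub_right a
  rw [integral_stdGaussian, integral_stdGaussian]
  simp only [smul_eq_mul]
  rw [← integral_sub_right_eq_self (fun z : E => gaussDensity z * φ (z + a)) a]
  simp only [sub_add_cancel]
  rw [← integral_sub (hpa.mul_bdd hφ.aestronglyMeasurable (.of_forall hB))
    (hpi.mul_bdd hφ.aestronglyMeasurable (.of_forall hB))]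
  have hB0 : 0 ≤ B := (abs_nonneg _).trans (hB 0)
  calc _ ≤ ∫ x : E, B * |gaussDensity (x - a) - gaussDensity x| := by
        refine norm_integral_le_of_norm_le (G := ℝ) (((hpa.sub hpi).abs).const_mul B)
          (.of_forall fun x => ?_)
        rw [← sub_mul, norm_mul, mul_comm, Real.norm_eq_abs, Real.norm_eq_abs]
        exact mul_le_mul_of_nonneg_right (hB x) (abs_nonneg _)
    _ ≤ B * ‖a‖ := by
        rw [integral_const_mul]
        exact mul_le_mul_of_nonneg_left (integral_abs_gaussDensity_sub_le a) hB0

end Gaussian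

/-! ### Gaussian smoothing of Lipschitz vector fields -/

section Smoothing

open scoped NNReal

variable {E : Type*} [NormedAddCommGroup E]

lemma norm_le_of_lipschitz {G : E → E} {M : ℝ≥0} (hG : LipschitzWith M G) (x : E) :
    ‖G x‖ ≤ ‖G 0‖ + M * ‖x‖ := by
  have := hG.norm_sub_le x 0
  have h2 := norm_sub_norm_le (G x) (G 0)
  rw [sub_zero] at this
  linarith

variable [InnerProductSpace ℝ E]

/-- The quadratic form `u ↦ ⟨DG(x) u, u⟩` of the derivative of a vector field `G`; for `G = ∇h` it
is the Hessian form of `h` at `x`. -/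
noncomputable def derivQuad (G : E → E) (x u : E) : ℝ := inner ℝ (fderiv ℝ G x u) u

lemma abs_derivQuad_le {G : E → E} {M : ℝ≥0} (hG : LipschitzWith M G) (x u : E) :
    |derivQuad G x u| ≤ M * ‖u‖ ^ 2 := by
  refine (abs_real_inner_le_norm _ _).trans ?_
  have := (fderiv ℝ G x).le_of_opNorm_le (norm_fderiv_le_of_lipschitz ℝ hG (x₀ := x)) u
  nlinarith [norm_nonneg u]

variable [FiniteDimensional ℝ E] [MeasurableSpace E] [BorelSpace E]

lemma measurable_derivQuad (G : E → E) : Measurable (fun p : E × E => derivQuad G p.1 p.2) := by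
  unfold derivQuad
  have h1 : Measurable (fun p : E × E => (fderiv ℝ G p.1, p.2)) :=
    ((measurable_fderiv ℝ G).comp measurable_fst).prodMk measurable_snd
  have h2 : Measurable (fun p : E × E => fderiv ℝ G p.1 p.2) :=
    ContinuousLinearMap.measurable_apply₂.comp h1
  exact h2.inner measurable_snd

lemma measurable_derivQuad_comp {α : Type*} [MeasurableSpace α] (G : E → E) {f g : α → E}
    (hf : Measurable f) (hg : Measurable g) : Measurable (fun a => derivQuad G (f a) (g a)) :=
  (measurable_derivQuad G).comp (g := derivQuad G |> Function.uncurry) (hf.prodMk hg)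

lemma integrable_norm_stdGaussian : Integrable (fun x : E => ‖x‖) (stdGaussian E) :=
  IsGaussian.integrable_id.norm

lemma memLp_norm_stdGaussian : MemLp (fun x : E => ‖x‖) 2 (stdGaussian E) :=
  IsGaussian.memLp_two_id.norm

/-- The form `derivQuad G` averaged over the Gaussian vector `x + A Z`. -/
noncomputable def smoothQuad (G : E → E) (A : E →L[ℝ] E) (x u : E) : ℝ :=
  ∫ z, derivQuad G (x + A z) u ∂(stdGaussian E)

lemma integrable_derivQuad_add {G : E → E} {M : ℝ≥0} (hG : LipschitzWith M G) (A : E →L[ℝ] E)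
    (x u : E) : Integrable (fun z => derivQuad G (x + A z) u) (stdGaussian E) := by
  refine Integrable.of_bound (C := M * ‖u‖ ^ 2) ?_ (.of_forall fun z => abs_derivQuad_le hG _ _)
  exact (measurable_derivQuad_comp G (by fun_prop) measurable_const).aestronglyMeasurable

lemma abs_smoothQuad_le {G : E → E} {M : ℝ≥0} (hG : LipschitzWith M G) (A : E →L[ℝ] E)
    (x u : E) : |smoothQuad G A x u| ≤ M * ‖u‖ ^ 2 := by
  have := norm_integral_le_of_norm_le_const (μ := stdGaussian E)
    (f := fun z => derivQuad G (x + A z) u) (.of_forall fun z => abs_derivQuad_le hG (x + A z) u)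
  simpa [smoothQuad] using this

lemma measurable_smoothQuad (G : E → E) (A : E →L[ℝ] E) :
    Measurable (fun p : E × E => smoothQuad G A p.1 p.2) := by
  have h : Measurable (fun q : (E × E) × E => derivQuad G (q.1.1 + A q.2) q.1.2) :=
    measurable_derivQuad_comp G (by fun_prop) (by fun_prop)
  exact (h.stronglyMeasurable.integral_prod_right (ν := stdGaussian E)).measurable

/-- Gaussian smoothing makes the derivative of a Lipschitz field Lipschitz, in the metric given by
the inverse of `A`. -/
lemma abs_smoothQuad_sub_le {G : E → E} {M : ℝ≥0} (hG : LipschitzWith M G) {A A' : E →L[ℝ] E}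
    (hA : ∀ v, A (A' v) = v) (x y u : E) :
    |smoothQuad G A x u - smoothQuad G A y u| ≤ M * ‖u‖ ^ 2 * (‖A'‖ * ‖x - y‖) := by
  have hm : Measurable (fun z : E => derivQuad G (y + A z) u) :=
    measurable_derivQuad_comp G (by fun_prop) measurable_const
  have h := abs_integral_stdGaussian_add_sub_le hm (fun z => abs_derivQuad_le hG (y + A z) u)
    (A' (x - y))
  have e : ∀ z, y + A (z + A' (x - y)) = x + A z := fun z => by
    rw [map_add, hA]; abel
  simp only [e] at h
  refine h.trans ?_
  gcongr
  exact A'.le_opNorm _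

lemma memLp_inner_field {G : E → E} {M : ℝ≥0} (hG : LipschitzWith M G) (A : E →L[ℝ] E)
    (x u : E) : MemLp (fun z => inner ℝ (G (x + A z)) u) 2 (stdGaussian E) := by
  have hc : Continuous (fun z => inner ℝ (G (x + A z)) u) := by
    have := hG.continuous; fun_prop
  refine MemLp.mono' (g := fun z => (‖G 0‖ + M * (‖x‖ + ‖A‖ * ‖z‖)) * ‖u‖) ?_
    hc.aestronglyMeasurable (.of_forall fun z => ?_)
  · exact (((memLp_const ‖G 0‖).add (((memLp_const ‖x‖).add
      (memLp_norm_stdGaussian.const_mul ‖A‖)).const_mul (M : ℝ))).mul_const ‖u‖)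
  · refine (abs_real_inner_le_norm _ _).trans ?_
    gcongr
    refine (norm_le_of_lipschitz hG _).trans ?_
    gcongr
    exact (norm_add_le _ _).trans (by gcongr; exact A.le_opNorm _)

lemma integrable_inner_field {G : E → E} {M : ℝ≥0} (hG : LipschitzWith M G) (A : E →L[ℝ] E)
    (x u : E) : Integrable (fun z => inner ℝ (G (x + A z)) u) (stdGaussian E) :=
  (memLp_inner_field hG A x u).integrable one_le_two

lemma hasDerivAt_integral_inner_field {G : E → E} {M : ℝ≥0} (hG : LipschitzWith M G)
    (hd : Differentiable ℝ G) (A : E →L[ℝ] E) (a x : E) (t : ℝ) :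
    HasDerivAt (fun t : ℝ => ∫ z, inner ℝ (G (a + t • x + A z)) x ∂(stdGaussian E))
      (smoothQuad G A (a + t • x) x) t := by
  refine (hasDerivAt_integral_of_dominated_loc_of_deriv_le (s := Set.univ)
    (F' := fun t z => derivQuad G (a + t • x + A z) x) (bound := fun _ => M * ‖x‖ ^ 2)
    Filter.univ_mem (.of_forall fun s => (integrable_inner_field hG A _ _).aestronglyMeasurable)
    (integrable_inner_field hG A _ _) (integrable_derivQuad_add hG A _ _).aestronglyMeasurable
    (.of_forall fun z s _ => abs_derivQuad_le hG _ _) (integrable_const _)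
    (.of_forall fun z s _ => ?_)).2
  have h1 : HasDerivAt (fun s : ℝ => a + s • x + A z) x s := by
    simpa using (((hasDerivAt_id s).smul_const x).const_add a).add_const (A z)
  have h2 := ((hd (a + s • x + A z)).hasFDerivAt.comp_hasDerivAt s h1)
  simpa [derivQuad] using h2.inner ℝ (hasDerivAt_const s x)

/-- The first-order Taylor remainder of the smoothed field, whose derivative `smoothQuad G A` is
Lipschitz. -/
lemma abs_integral_inner_field_sub_le {G : E → E} {M : ℝ≥0} (hG : LipschitzWith M G)
    (hd : Differentiable ℝ G) {A A' : E →L[ℝ] E} (hA : ∀ v, A (A' v) = v) (a x : E) {s : ℝ}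
    (hs : 0 ≤ s) :
    |∫ z, inner ℝ (G (a + s • x + A z)) x ∂(stdGaussian E)
        - ∫ z, inner ℝ (G (a + A z)) x ∂(stdGaussian E) - s * smoothQuad G A a x|
      ≤ M * ‖A'‖ * ‖x‖ ^ 3 * (s ^ 2 / 2) := by
  set q : ℝ → ℝ := fun t => ∫ z, inner ℝ (G (a + t • x + A z)) x ∂(stdGaussian E)
  have hq : ∀ t, HasDerivAt q (smoothQuad G A (a + t • x) x) t :=
    hasDerivAt_integral_inner_field hG hd A a x
  have hf : ∀ t, HasDerivAt (fun t => q t - q 0 - t * smoothQuad G A a x)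
      (smoothQuad G A (a + t • x) x - smoothQuad G A a x) t := fun t => by
    refine (((hq t).sub_const (q 0)).fun_sub
      ((hasDerivAt_id t).mul_const (smoothQuad G A a x))).congr_deriv ?_
    simp
  have hB : ∀ t, HasDerivAt (fun t : ℝ => M * ‖A'‖ * ‖x‖ ^ 3 * (t ^ 2 / 2))
      (M * ‖A'‖ * ‖x‖ ^ 3 * t) t := fun t => by
    refine ((((hasDerivAt_id t).pow 2).div_const 2).const_mul _).congr_deriv ?_
    simp
  have := image_norm_le_of_norm_deriv_right_le_deriv_boundary' (a := 0) (b := s)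
    (f := fun t => q t - q 0 - t * smoothQuad G A a x)
    (fun t _ => (hf t).continuousAt.continuousWithinAt)
    (fun t _ => (hf t).hasDerivWithinAt) (by simp)
    (fun t _ => (hB t).continuousAt.continuousWithinAt) (fun t _ => (hB t).hasDerivWithinAt)
    (fun t ht => by
      refine (abs_smoothQuad_sub_le hG hA _ _ _).trans (le_of_eq ?_)
      rw [add_sub_cancel_left, norm_smul, Real.norm_eq_abs, abs_of_nonneg ht.1]
      ring) (Set.right_mem_Icc.2 hs)
  simpa [q] using this

/-- Gaussian integration by parts for `⟨G(c + t B Z), B Z⟩`. -/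
lemma integral_inner_field_apply {G : E → E} {M : ℝ≥0} (hG : LipschitzWith M G)
    (hd : Differentiable ℝ G) (B : E →L[ℝ] E) (c : E) (t : ℝ) :
    ∫ z, inner ℝ (G (c + t • B z)) (B z) ∂(stdGaussian E) =
      t * ∫ z, ∑ i, derivQuad G (c + t • B z) (B (stdOrthonormalBasis ℝ E i))
        ∂(stdGaussian E) := by
  set e := stdOrthonormalBasis ℝ E
  have hi : ∀ i, Integrable (fun z => inner ℝ (G (c + t • B z)) (B (e i))) (stdGaussian E) :=
    fun i => integrable_inner_field hG (t • B) c _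
  have hi2 : ∀ i, Integrable (fun z => inner ℝ (e i) z * inner ℝ (G (c + t • B z)) (B (e i)))
      (stdGaussian E) := by
    intro i
    refine MemLp.integrable_mul (p := 2) (q := 2) ?_ (memLp_inner_field hG (t • B) c _)
    exact IsGaussian.memLp_two_id.norm.mono' (by fun_prop) (.of_forall fun z => by
      simpa using (norm_inner_le_norm (𝕜 := ℝ) (e i) z))
  have h1 : ∀ z, inner ℝ (G (c + t • B z)) (B z) =
      ∑ i, inner ℝ (e i) z * inner ℝ (G (c + t • B z)) (B (e i)) := by
    intro z
    have hz : B z = ∑ i, inner ℝ (e i) z • B (e i) := by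
      conv_lhs => rw [← e.sum_repr' z, map_sum]
      simp only [map_smul]
    generalize G (c + t • B z) = w
    rw [hz, inner_sum]
    simp only [inner_smul_right]
  have h3 : ∀ i, ∀ z, HasLineDerivAt ℝ (fun z => inner ℝ (G (c + t • B z)) (B (e i)))
      (t * derivQuad G (c + t • B z) (B (e i))) z (e i) := by
    intro i z
    have h4 : HasFDerivAt (fun z => c + t • B z) (t • B) z :=
      ((t • B).hasFDerivAt).const_add c
    have h5 := ((hd (c + t • B z)).hasFDerivAt.comp z h4).inner ℝ (hasFDerivAt_const (B (e i)) z)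
    refine (h5.hasLineDerivAt (e i)).congr_deriv ?_
    simp [derivQuad, inner_smul_left]
  have hi3 : ∀ i, Integrable (fun z => derivQuad G (c + t • B z) (B (e i))) (stdGaussian E) :=
    fun i => integrable_derivQuad_add hG (t • B) c _
  simp only [h1]
  rw [integral_finsetSum _ fun i _ => hi2 i, integral_finsetSum _ fun i _ => hi3 i, Finset.mul_sum]
  refine Finset.sum_congr rfl fun i _ => ?_
  rw [integral_inner_mul_stdGaussian (e i) (h3 i) (hi i) (hi2 i) ((hi3 i).const_mul t),
    integral_const_mul]

end Smoothing

/-! ### Comparison of a centred law with an independent copy -/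

section OneStep

open scoped NNReal

variable {E : Type*} [NormedAddCommGroup E]

lemma integrable_norm_pow_of_norm_cube [MeasurableSpace E] [BorelSpace E]
    {ν : Measure E} [IsFiniteMeasure ν] (h3 : Integrable (fun x => ‖x‖ ^ 3) ν) {k : ℕ}
    (hk : k ≤ 3) : Integrable (fun x => ‖x‖ ^ k) ν := by
  refine Integrable.mono' ((integrable_const (1 : ℝ)).add h3)
    (by fun_prop) (.of_forall fun x => ?_)
  rw [Real.norm_of_nonneg (by positivity)]
  rcases le_total ‖x‖ 1 with hx | hx
  · have := pow_le_one₀ (n := k) (norm_nonneg x) hx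
    have : 0 ≤ ‖x‖ ^ 3 := by positivity
    simp only [Pi.add_apply]; linarith
  · have := pow_le_pow_right₀ hx hk
    simp only [Pi.add_apply]; linarith

variable [InnerProductSpace ℝ E] [FiniteDimensional ℝ E]

/-- Quadratic growth of a function with Lipschitz gradient. -/
lemma abs_le_of_lipschitz_gradient {h : E → ℝ} {M : ℝ≥0} (hh : Differentiable ℝ h)
    (hG : LipschitzWith M (gradient h)) (x : E) :
    |h x| ≤ |h 0| + (‖gradient h 0‖ + M * ‖x‖) * ‖x‖ := by
  have := (convex_closedBall (0 : E) ‖x‖).norm_image_sub_le_of_norm_hasFDerivWithin_le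
    (f := h) (C := ‖gradient h 0‖ + M * ‖x‖) (x := 0) (y := x)
    (fun y _ => ((hh y).hasGradientAt.hasFDerivAt).hasFDerivWithinAt)
    (fun y hy => by
      rw [LinearIsometryEquiv.norm_map]
      refine (norm_le_of_lipschitz hG y).trans ?_
      gcongr
      simpa using hy) (by simp) (by simp)
  rw [sub_zero, Real.norm_eq_abs] at this
  have := abs_sub_abs_le_abs_sub (h x) (h 0)
  linarith

variable [MeasurableSpace E] [BorelSpace E]

lemma integral_smoothQuad {G : E → E} {M : ℝ≥0} (hG : LipschitzWith M G) (A : E →L[ℝ] E) (x : E)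
    {ν : Measure E} [IsFiniteMeasure ν] (h2 : Integrable (fun y => ‖y‖ ^ 2) ν) :
    ∫ y, smoothQuad G A x y ∂ν = ∫ z, ∫ y, derivQuad G (x + A z) y ∂ν ∂(stdGaussian E) := by
  unfold smoothQuad
  refine integral_integral_swap (f := fun y z => derivQuad G (x + A z) y) ?_
  refine Integrable.mono' ((h2.const_mul (M : ℝ)).comp_fst (stdGaussian E)) ?_
    (.of_forall fun p => abs_derivQuad_le hG _ _)
  exact (measurable_derivQuad_comp G (by fun_prop) (by fun_prop)).aestronglyMeasurable

/-- Stein-type comparison: for a centred law `ν` with third moment, `⟨G(a + s x + A Z), x⟩` is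
approximated in mean by `s ⟨DG(a + s x + A Z) y, y⟩`, where `y` is an independent copy of `x`.
Both are compared with `s ⟨DG(a + A Z) x, x⟩`; the two errors contribute `1/2` and `1` to the
factor `3/2`. -/
lemma abs_integral_inner_field_sub_integral_smoothQuad_le {G : E → E} {M : ℝ≥0}
    (hG : LipschitzWith M G) (hd : Differentiable ℝ G) {A A' : E →L[ℝ] E}
    (hA : ∀ v, A (A' v) = v) {ν : Measure E} [IsProbabilityMeasure ν]
    (h3 : Integrable (fun x => ‖x‖ ^ 3) ν) (hmean : ∫ x, x ∂ν = 0) (a : E) {s : ℝ} (hs : 0 ≤ s) :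
    |∫ x, ∫ z, inner ℝ (G (a + s • x + A z)) x ∂(stdGaussian E) ∂ν
        - s * ∫ x, ∫ y, smoothQuad G A (a + s • x) y ∂ν ∂ν|
      ≤ 3 / 2 * s ^ 2 * (M * ‖A'‖ * ∫ x, ‖x‖ ^ 3 ∂ν) := by
  have h2 : Integrable (fun x => ‖x‖ ^ 2) ν := integrable_norm_pow_of_norm_cube h3 (by norm_num)
  have h1 : Integrable (fun x => ‖x‖) ν := by
    simpa using integrable_norm_pow_of_norm_cube h3 (k := 1) (by norm_num)
  have hid : Integrable (fun x : E => x) ν := (integrable_norm_iff (by fun_prop)).1 h1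
  have hGc := hG.continuous
  have hK : Measurable (fun p : E × E => smoothQuad G A p.1 p.2) := measurable_smoothQuad G A
  have hKi : ∀ w, Integrable (fun y => smoothQuad G A w y) ν := fun w =>
    Integrable.mono' (h2.const_mul (M : ℝ))
      (hK.comp (f := fun y : E => (w, y)) (by fun_prop)).aestronglyMeasurable
      (.of_forall fun y => abs_smoothQuad_le hG _ _ _)
  set F1 : E → ℝ := fun x => ∫ z, inner ℝ (G (a + s • x + A z)) x ∂(stdGaussian E)
  have hF1 : Measurable F1 := by
    have hc : Continuous (fun p : E × E => inner ℝ (G (a + s • p.1 + A p.2)) p.1) := by fun_prop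
    exact (hc.stronglyMeasurable.integral_prod_right (ν := stdGaussian E)).measurable
  set g : E := ∫ z, G (a + A z) ∂(stdGaussian E)
  have hF0 : ∀ x, ∫ z, inner ℝ (G (a + A z)) x ∂(stdGaussian E) = inner ℝ x g := fun x => by
    simp only [g, real_inner_comm x]
    refine integral_inner ?_ x
    refine Integrable.mono' (g := fun z => ‖G 0‖ + M * (‖a‖ + ‖A‖ * ‖z‖)) ?_
      (by fun_prop) (.of_forall fun z => ?_)
    · exact (integrable_const _).add (((integrable_const _).add
        (integrable_norm_stdGaussian.const_mul _)).const_mul _)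
    · refine (norm_le_of_lipschitz hG _).trans ?_
      gcongr
      exact (norm_add_le _ _).trans (by gcongr; exact A.le_opNorm _)
  set R : E → ℝ := fun x => F1 x - inner ℝ x g - s * smoothQuad G A a x
  have hR : ∀ x, |R x| ≤ M * ‖A'‖ * ‖x‖ ^ 3 * (s ^ 2 / 2) := fun x => by
    have := abs_integral_inner_field_sub_le hG hd hA a x hs
    rwa [hF0] at this
  have hRi : Integrable R ν := by
    refine Integrable.mono' (((h3.const_mul (M * ‖A'‖)).mul_const (s ^ 2 / 2))) ?_
      (.of_forall hR)
    exact ((hF1.sub (by fun_prop)).sub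
      ((hK.comp (f := fun y : E => (a, y)) (by fun_prop)).const_mul s)).aestronglyMeasurable
  set Q : E → ℝ := fun x => ∫ y, smoothQuad G A (a + s • x) y ∂ν
  have hQm : Measurable Q := by
    have : Measurable (fun p : E × E => smoothQuad G A (a + s • p.1) p.2) :=
      hK.comp (f := fun p : E × E => (a + s • p.1, p.2)) (by fun_prop)
    exact (this.stronglyMeasurable.integral_prod_right (ν := ν)).measurable
  set k : ℝ := ∫ y, smoothQuad G A a y ∂ν
  set m : ℝ := ∫ x, ‖x‖ ^ 3 ∂ν
  set m2 : ℝ := ∫ x, ‖x‖ ^ 2 ∂ν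
  set m1 : ℝ := ∫ x, ‖x‖ ∂ν
  have hQk : ∀ x, |Q x - k| ≤ M * m2 * ‖A'‖ * s * ‖x‖ := fun x => by
    simp only [Q, k]
    rw [← integral_sub (hKi _) (hKi _)]
    refine (norm_integral_le_of_norm_le (G := ℝ)
      (h2.const_mul (M * ‖A'‖ * s * ‖x‖)) (.of_forall fun y => ?_)).trans (le_of_eq ?_)
    · refine (abs_smoothQuad_sub_le hG hA _ _ _).trans (le_of_eq ?_)
      rw [add_sub_cancel_left, norm_smul, Real.norm_eq_abs, abs_of_nonneg hs]
      ring
    · rw [integral_const_mul]; ring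
  have hQki : Integrable (fun x => Q x - k) ν :=
    Integrable.mono' (h1.const_mul _) (hQm.sub_const k).aestronglyMeasurable (.of_forall hQk)
  have hQi : Integrable Q ν :=
    (hQki.add (integrable_const k)).congr (.of_forall fun x => by simp)
  have e1 : ∫ x, F1 x ∂ν = ∫ x, R x ∂ν + s * k := by
    have e : ∀ x, F1 x = R x + inner ℝ x g + s * smoothQuad G A a x := fun x => by
      simp only [R]; ring
    have hig : Integrable (fun x => inner ℝ x g) ν := hid.inner_const g
    simp only [e]
    rw [integral_add (f := fun x => R x + inner ℝ x g) (hRi.add hig) ((hKi a).const_mul s),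
      integral_add hRi hig, integral_const_mul]
    have : ∫ x, inner ℝ x g ∂ν = 0 := by
      simp only [real_inner_comm g]
      rw [integral_inner hid, hmean, inner_zero_right]
    rw [this, add_zero]
  have e2 : ∫ x, Q x ∂ν = ∫ x, (Q x - k) ∂ν + k := by
    rw [integral_sub hQi (integrable_const k)]; simp
  have b1 : |∫ x, R x ∂ν| ≤ M * ‖A'‖ * m * (s ^ 2 / 2) := by
    refine (norm_integral_le_of_norm_le (G := ℝ)
      ((h3.const_mul (M * ‖A'‖)).mul_const (s ^ 2 / 2)) (.of_forall hR)).trans (le_of_eq ?_)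
    rw [integral_mul_const, integral_const_mul]
  have b2 : |∫ x, (Q x - k) ∂ν| ≤ M * ‖A'‖ * s * (m2 * m1) := by
    refine (norm_integral_le_of_norm_le (G := ℝ) (h1.const_mul _) (.of_forall hQk)).trans
      (le_of_eq ?_)
    rw [integral_const_mul]; ring
  have b3 : m2 * m1 ≤ m := by
    -- Young's inequality `‖x‖² ‖y‖ ≤ (2 ‖x‖³ + ‖y‖³) / 3` for an independent copy `y`
    have hle : ∀ y : E, m2 * ‖y‖ ≤ (2 * m + ‖y‖ ^ 3) / 3 := fun y => by
      have : ∫ x, ‖x‖ ^ 2 * ‖y‖ ∂ν ≤ ∫ x, (2 * ‖x‖ ^ 3 + ‖y‖ ^ 3) / 3 ∂ν := by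
        refine integral_mono (h2.mul_const _)
          (((h3.const_mul 2).add (integrable_const _)).div_const 3) fun x => ?_
        have hx := norm_nonneg x
        have hy := norm_nonneg y
        have := mul_nonneg (by positivity : 0 ≤ 2 * ‖x‖ + ‖y‖) (sq_nonneg (‖x‖ - ‖y‖))
        simp only
        nlinarith
      rw [integral_mul_const, integral_div, integral_add (h3.const_mul 2) (integrable_const _),
        integral_const_mul] at this
      simpa using this
    have : ∫ y, m2 * ‖y‖ ∂ν ≤ ∫ y, (2 * m + ‖y‖ ^ 3) / 3 ∂ν :=
      integral_mono (h1.const_mul _) (((integrable_const _).add h3).div_const 3) hle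
    rw [integral_const_mul, integral_div, integral_add (integrable_const _) h3] at this
    simp only [integral_const, probReal_univ, smul_eq_mul, one_mul] at this
    linarith
  rw [e1, e2]
  have : ∫ x, R x ∂ν + s * k - s * (∫ x, (Q x - k) ∂ν + k)
      = ∫ x, R x ∂ν - s * ∫ x, (Q x - k) ∂ν := by ring
  rw [this]
  refine (abs_sub _ _).trans ?_
  rw [abs_mul, abs_of_nonneg hs]
  have hc : 0 ≤ M * ‖A'‖ * s ^ 2 := by positivity
  have b4 := mul_le_mul_of_nonneg_left b2 hs
  have b5 := mul_le_mul_of_nonneg_left b3 hc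
  linarith

end OneStep

/-! ### Interpolation along the rotation path -/

section Interpolation

open scoped NNReal

variable {E : Type*} [NormedAddCommGroup E] [InnerProductSpace ℝ E]

/-- The rotation path from `s + A z` (at `θ = 0`) to `s + x + B z'` (at `θ = π/2`), as a function
of `p = (z', x, z)`. -/
noncomputable def rotPath (A B : E →L[ℝ] E) (s : E) (θ : ℝ) (p : E × E × E) : E :=
  s + Real.sin θ • (p.2.1 + B p.1) + Real.cos θ • A p.2.2

/-- A bound, uniform in `θ`, for `‖rotPath A B s θ p - s‖` and for the velocity of the path. -/
noncomputable def rotSize (A B : E →L[ℝ] E) (p : E × E × E) : ℝ :=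
  ‖p.2.1‖ + ‖B‖ * ‖p.1‖ + ‖A‖ * ‖p.2.2‖

lemma continuous_rotPath (A B : E →L[ℝ] E) (s : E) (θ : ℝ) : Continuous (rotPath A B s θ) := by
  unfold rotPath; fun_prop

lemma hasDerivAt_rotPath (A B : E →L[ℝ] E) (s : E) (θ : ℝ) (p : E × E × E) :
    HasDerivAt (fun θ => rotPath A B s θ p)
      (Real.cos θ • (p.2.1 + B p.1) + (-Real.sin θ) • A p.2.2) θ := by
  unfold rotPath
  exact (((Real.hasDerivAt_sin θ).smul_const _).const_add s).add
    ((Real.hasDerivAt_cos θ).smul_const _)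

lemma norm_smul_add_smul_le (A B : E →L[ℝ] E) {c c' : ℝ} (hc : |c| ≤ 1) (hc' : |c'| ≤ 1)
    (p : E × E × E) : ‖c • (p.2.1 + B p.1) + c' • A p.2.2‖ ≤ rotSize A B p := by
  refine (norm_add_le _ _).trans ?_
  rw [norm_smul, norm_smul]
  refine add_le_add ?_ ?_
  · refine (mul_le_of_le_one_left (norm_nonneg _) hc).trans ((norm_add_le _ _).trans ?_)
    gcongr
    exact B.le_opNorm _
  · exact (mul_le_of_le_one_left (norm_nonneg _) hc').trans (A.le_opNorm _)

lemma norm_rotPath_le (A B : E →L[ℝ] E) (s : E) (θ : ℝ) (p : E × E × E) :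
    ‖rotPath A B s θ p‖ ≤ ‖s‖ + rotSize A B p := by
  unfold rotPath
  rw [add_assoc]
  exact (norm_add_le _ _).trans (by
    gcongr
    exact norm_smul_add_smul_le A B (Real.abs_sin_le_one θ) (Real.abs_cos_le_one θ) p)

variable [FiniteDimensional ℝ E] [MeasurableSpace E] [BorelSpace E]

variable {ν : Measure E} [IsProbabilityMeasure ν]

variable (ν) in
/-- The joint law of `(Z', X, Z)`: independent, `Z'` and `Z` standard Gaussian, `X` with law `ν`. -/
noncomputable def rotMeasure : Measure (E × E × E) :=
  (stdGaussian E).prod (ν.prod (stdGaussian E))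

instance : IsProbabilityMeasure (rotMeasure ν) := by unfold rotMeasure; infer_instance

lemma memLp_rotSize (A B : E →L[ℝ] E) (h2 : Integrable (fun x => ‖x‖ ^ 2) ν) :
    MemLp (rotSize A B) 2 (rotMeasure ν) := by
  have hν : MemLp (fun x : E => ‖x‖) 2 ν := (memLp_two_iff_integrable_sq (by fun_prop)).2 h2
  have hγ : MemLp (fun x : E => ‖x‖) 2 (stdGaussian E) := memLp_norm_stdGaussian
  have h1 : MemLp (fun p : E × E × E => ‖p.2.1‖) 2 (rotMeasure ν) :=
    (hν.comp_fst (stdGaussian E)).comp_snd (stdGaussian E)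
  have h2 : MemLp (fun p : E × E × E => ‖p.1‖) 2 (rotMeasure ν) :=
    hγ.comp_fst (ν.prod (stdGaussian E))
  have h3 : MemLp (fun p : E × E × E => ‖p.2.2‖) 2 (rotMeasure ν) :=
    (hγ.comp_snd ν).comp_snd (stdGaussian E)
  exact (h1.add (h2.const_mul ‖B‖)).add (h3.const_mul ‖A‖)

lemma integrable_add_mul_rotSize (A B : E →L[ℝ] E) (h2 : Integrable (fun x => ‖x‖ ^ 2) ν)
    (a b : ℝ) : Integrable (fun p => (a + b * rotSize A B p) * rotSize A B p) (rotMeasure ν) := by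
  have := memLp_rotSize A B h2
  exact MemLp.integrable_mul (p := 2) (q := 2) ((memLp_const a).add (this.const_mul b)) this

variable {h : E → ℝ} {M : ℝ≥0}

lemma integrable_rotPath (A B : E →L[ℝ] E) (h2 : Integrable (fun x => ‖x‖ ^ 2) ν)
    (hh : Differentiable ℝ h) (hG : LipschitzWith M (gradient h)) (s : E) (θ : ℝ) :
    Integrable (fun p => h (rotPath A B s θ p)) (rotMeasure ν) := by
  have hi := memLp_rotSize A B h2
  have hi2 : MemLp (fun p => ‖s‖ + rotSize A B p) 2 (rotMeasure ν) :=
    (memLp_const ‖s‖).add hi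
  have hi3 : MemLp (fun p => ‖gradient h 0‖ + M * (‖s‖ + rotSize A B p)) 2 (rotMeasure ν) :=
    (memLp_const ‖gradient h 0‖).add (hi2.const_mul (M : ℝ))
  have hi4 : Integrable (fun p => |h 0| + (‖gradient h 0‖ + M * (‖s‖ + rotSize A B p)) *
      (‖s‖ + rotSize A B p)) (rotMeasure ν) :=
    (integrable_const |h 0|).add (MemLp.integrable_mul (p := 2) (q := 2) hi3 hi2)
  have hm : AEStronglyMeasurable (fun p => h (rotPath A B s θ p)) (rotMeasure ν) :=
    (hh.continuous.comp (continuous_rotPath A B s θ)).aestronglyMeasurable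
  refine Integrable.mono' hi4 hm (ae_of_all _ fun p => ?_)
  have h1 := norm_rotPath_le A B s θ p
  have h3 := mul_le_mul_of_nonneg_left h1 M.coe_nonneg
  have h4 : (‖gradient h 0‖ + M * ‖rotPath A B s θ p‖) * ‖rotPath A B s θ p‖ ≤
      (‖gradient h 0‖ + M * (‖s‖ + rotSize A B p)) * (‖s‖ + rotSize A B p) :=
    mul_le_mul (by linarith) h1 (norm_nonneg _)
      (add_nonneg (norm_nonneg _) ((mul_nonneg M.coe_nonneg (norm_nonneg _)).trans h3))
  exact (abs_le_of_lipschitz_gradient hh hG _).trans (add_le_add le_rfl h4)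

lemma integrable_inner_rotPath {G : E → E} (hG : LipschitzWith M G) (A B : E →L[ℝ] E)
    (h2 : Integrable (fun x => ‖x‖ ^ 2) ν) (s : E) (θ : ℝ) {v : E × E × E → E}
    (hv : Continuous v) (hv2 : ∀ p, ‖v p‖ ≤ rotSize A B p) :
    Integrable (fun p => inner ℝ (G (rotPath A B s θ p)) (v p)) (rotMeasure ν) := by
  refine (integrable_add_mul_rotSize A B h2 (‖G 0‖ + M * ‖s‖) M).mono' ?_ (.of_forall fun p => ?_)
  · exact ((hG.continuous.comp (continuous_rotPath A B s θ)).inner hv).aestronglyMeasurable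
  · refine (abs_real_inner_le_norm _ _).trans ?_
    have h1 := norm_le_of_lipschitz hG (rotPath A B s θ p)
    have h3 := mul_le_mul_of_nonneg_left (norm_rotPath_le A B s θ p) M.coe_nonneg
    exact mul_le_mul (by linarith) (hv2 p) (norm_nonneg _)
      ((norm_nonneg _).trans (h1.trans (by linarith)))

lemma hasDerivAt_integral_rotPath (A B : E →L[ℝ] E) (h2 : Integrable (fun x => ‖x‖ ^ 2) ν)
    (hh : Differentiable ℝ h) (hG : LipschitzWith M (gradient h)) (s : E) (θ : ℝ) :
    HasDerivAt (fun θ => ∫ p, h (rotPath A B s θ p) ∂(rotMeasure ν))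
      (∫ p, inner ℝ (gradient h (rotPath A B s θ p))
        (Real.cos θ • (p.2.1 + B p.1) + (-Real.sin θ) • A p.2.2) ∂(rotMeasure ν)) θ := by
  have hv : ∀ θ p, ‖Real.cos θ • (p.2.1 + B p.1) + (-Real.sin θ) • A p.2.2‖ ≤ rotSize A B p :=
    fun θ p => norm_smul_add_smul_le A B (Real.abs_cos_le_one θ)
      (by rw [abs_neg]; exact Real.abs_sin_le_one θ) p
  refine (hasDerivAt_integral_of_dominated_loc_of_deriv_le (s := Set.univ)
    (F' := fun θ p => inner ℝ (gradient h (rotPath A B s θ p))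
        (Real.cos θ • (p.2.1 + B p.1) + (-Real.sin θ) • A p.2.2))
    (bound := fun p => ((‖gradient h 0‖ + M * ‖s‖) + M * rotSize A B p) * rotSize A B p)
    Filter.univ_mem
    (.of_forall fun t => (integrable_rotPath A B h2 hh hG s t).aestronglyMeasurable)
    (integrable_rotPath A B h2 hh hG s θ)
    (integrable_inner_rotPath hG A B h2 s θ (by fun_prop) (hv θ)).aestronglyMeasurable
    (.of_forall fun p t _ => ?_) (integrable_add_mul_rotSize A B h2 _ _)
    (.of_forall fun p t _ => ?_)).2
  · refine (abs_real_inner_le_norm _ _).trans ?_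
    have h1 := norm_le_of_lipschitz hG (rotPath A B s t p)
    have h3 := mul_le_mul_of_nonneg_left (norm_rotPath_le A B s t p) M.coe_nonneg
    exact mul_le_mul (by linarith) (hv t p) (norm_nonneg _)
      ((norm_nonneg _).trans (h1.trans (by linarith)))
  · have := (hh (rotPath A B s t p)).hasGradientAt.hasFDerivAt.comp_hasDerivAt t
      (hasDerivAt_rotPath A B s t p)
    exact this.congr_deriv (by simp)

lemma integrable_derivQuad_rotPath {G : E → E} (hG : LipschitzWith M G) (A B : E →L[ℝ] E)
    (s : E) (θ : ℝ) (u : E) :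
    Integrable (fun p => derivQuad G (rotPath A B s θ p) u) (rotMeasure ν) :=
  Integrable.of_bound (C := M * ‖u‖ ^ 2) (measurable_derivQuad_comp G
    (continuous_rotPath A B s θ).measurable measurable_const).aestronglyMeasurable
    (.of_forall fun _ => abs_derivQuad_le hG _ _)

/-- Gaussian integration by parts in `Z'`. -/
lemma integral_inner_rotPath_fst {G : E → E} (hG : LipschitzWith M G) (hd : Differentiable ℝ G)
    (A B : E →L[ℝ] E) (h2 : Integrable (fun x => ‖x‖ ^ 2) ν) (s : E) (θ : ℝ) :
    ∫ p, inner ℝ (G (rotPath A B s θ p)) (B p.1) ∂(rotMeasure ν) =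
      Real.sin θ * ∫ p, ∑ i, derivQuad G (rotPath A B s θ p) (B (stdOrthonormalBasis ℝ E i))
        ∂(rotMeasure ν) := by
  have hi := integrable_inner_rotPath hG A B h2 s θ (v := fun p => B p.1) (by fun_prop)
    (fun p => by
      unfold rotSize
      have := B.le_opNorm p.1
      have : 0 ≤ ‖A‖ * ‖p.2.2‖ := by positivity
      linarith [norm_nonneg p.2.1])
  have hi2 : Integrable (fun p => ∑ i, derivQuad G (rotPath A B s θ p)
      (B (stdOrthonormalBasis ℝ E i))) (rotMeasure ν) :=
    integrable_finsetSum _ fun i _ => integrable_derivQuad_rotPath hG A B s θ _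
  unfold rotMeasure at *
  rw [integral_prod_symm _ hi, integral_prod_symm _ hi2, ← integral_const_mul]
  congr 1
  ext q
  have e : ∀ z, rotPath A B s θ (z, q) =
      (s + Real.sin θ • q.1 + Real.cos θ • A q.2) + Real.sin θ • B z := fun z => by
    simp only [rotPath, smul_add]; abel
  simp only [e]
  exact integral_inner_field_apply hG hd B _ _

/-- Gaussian integration by parts in `Z`. -/
lemma integral_inner_rotPath_snd {G : E → E} (hG : LipschitzWith M G) (hd : Differentiable ℝ G)
    (A B : E →L[ℝ] E) (h2 : Integrable (fun x => ‖x‖ ^ 2) ν) (s : E) (θ : ℝ) :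
    ∫ p, inner ℝ (G (rotPath A B s θ p)) (A p.2.2) ∂(rotMeasure ν) =
      Real.cos θ * ∫ p, ∑ i, derivQuad G (rotPath A B s θ p) (A (stdOrthonormalBasis ℝ E i))
        ∂(rotMeasure ν) := by
  have hi := integrable_inner_rotPath hG A B h2 s θ (v := fun p => A p.2.2) (by fun_prop)
    (fun p => by
      unfold rotSize
      have := A.le_opNorm p.2.2
      have : 0 ≤ ‖B‖ * ‖p.1‖ := by positivity
      linarith [norm_nonneg p.2.1])
  have hi2 : Integrable (fun p => ∑ i, derivQuad G (rotPath A B s θ p)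
      (A (stdOrthonormalBasis ℝ E i))) (rotMeasure ν) :=
    integrable_finsetSum _ fun i _ => integrable_derivQuad_rotPath hG A B s θ _
  unfold rotMeasure at *
  rw [integral_prod _ hi, integral_prod _ hi2, ← integral_const_mul]
  refine integral_congr_ae ?_
  filter_upwards [hi.prod_right_ae, hi2.prod_right_ae] with z' hz hz2
  rw [integral_prod _ hz, integral_prod _ hz2, ← integral_const_mul]
  congr 1
  ext x
  have e : ∀ z, rotPath A B s θ (z', x, z) =
      (s + Real.sin θ • (x + B z')) + Real.cos θ • A z := fun z => rfl
  simp only [e]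
  exact integral_inner_field_apply hG hd A _ _

/-- The derivative of the interpolation along the rotation path. Integration by parts in `Z` and
`Z'` and the matching of the covariances leave `cos θ (E ⟨∇h(W), X⟩ - sin θ E ⟨D²h(W) Y, Y⟩)`, with
`W` the point on the path and `Y` an independent copy of `X`; the smoothing available at `W` is by
`cos θ • A`, whose inverse costs a factor `1 / cos θ` that cancels `cos θ`. -/
lemma abs_deriv_rotPath_le (hd : Differentiable ℝ (gradient h))
    (hG : LipschitzWith M (gradient h)) {A A' B : E →L[ℝ] E} (hA : ∀ v, A (A' v) = v)
    (h3 : Integrable (fun x => ‖x‖ ^ 3) ν) (hmean : ∫ x, x ∂ν = 0)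
    (hcov : ∀ T : E →L[ℝ] E, ∫ y, inner ℝ (T y) y ∂ν
      + ∑ i, inner ℝ (T (B (stdOrthonormalBasis ℝ E i))) (B (stdOrthonormalBasis ℝ E i))
      = ∑ i, inner ℝ (T (A (stdOrthonormalBasis ℝ E i))) (A (stdOrthonormalBasis ℝ E i)))
    (s : E) {θ : ℝ} (hs : 0 ≤ Real.sin θ) (hc : 0 < Real.cos θ) :
    |∫ p, inner ℝ (gradient h (rotPath A B s θ p))
        (Real.cos θ • (p.2.1 + B p.1) + (-Real.sin θ) • A p.2.2) ∂(rotMeasure ν)|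
      ≤ 3 / 2 * Real.sin θ ^ 2 * (M * ‖A'‖ * ∫ x, ‖x‖ ^ 3 ∂ν) := by
  have h2 : Integrable (fun x => ‖x‖ ^ 2) ν := integrable_norm_pow_of_norm_cube h3 (by norm_num)
  set G := gradient h
  set σ := Real.sin θ
  set c := Real.cos θ
  set e := stdOrthonormalBasis ℝ E
  set W := rotPath A B s θ
  have hiX : Integrable (fun p => inner ℝ (G (W p)) p.2.1) (rotMeasure ν) :=
    integrable_inner_rotPath hG A B h2 s θ (by fun_prop) (fun p => by
      unfold rotSize
      have : 0 ≤ ‖A‖ * ‖p.2.2‖ := by positivity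
      have : 0 ≤ ‖B‖ * ‖p.1‖ := by positivity
      linarith)
  have hiB : Integrable (fun p => inner ℝ (G (W p)) (B p.1)) (rotMeasure ν) :=
    integrable_inner_rotPath hG A B h2 s θ (by fun_prop) (fun p => by
      unfold rotSize
      have := B.le_opNorm p.1
      have : 0 ≤ ‖A‖ * ‖p.2.2‖ := by positivity
      linarith [norm_nonneg p.2.1])
  have hiA : Integrable (fun p => inner ℝ (G (W p)) (A p.2.2)) (rotMeasure ν) :=
    integrable_inner_rotPath hG A B h2 s θ (by fun_prop) (fun p => by
      unfold rotSize
      have := A.le_opNorm p.2.2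
      have : 0 ≤ ‖B‖ * ‖p.1‖ := by positivity
      linarith [norm_nonneg p.2.1])
  have hiQ : Integrable (fun p => ∫ y, derivQuad G (W p) y ∂ν) (rotMeasure ν) := by
    refine Integrable.of_bound (C := M * ∫ x, ‖x‖ ^ 2 ∂ν) ?_ (.of_forall fun p => ?_)
    · have : Measurable (fun q : (E × E × E) × E => derivQuad G (W q.1) q.2) :=
        measurable_derivQuad_comp G
          ((continuous_rotPath A B s θ).measurable.comp measurable_fst) measurable_snd
      exact (this.stronglyMeasurable.integral_prod_right (ν := ν)).aestronglyMeasurable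
    · rw [← integral_const_mul]
      exact norm_integral_le_of_norm_le (h2.const_mul _)
        (.of_forall fun y => abs_derivQuad_le hG _ _)
  have hiSB : Integrable (fun p => ∑ i, derivQuad G (W p) (B (e i))) (rotMeasure ν) :=
    integrable_finsetSum _ fun i _ => integrable_derivQuad_rotPath hG A B s θ _
  have hiSA : Integrable (fun p => ∑ i, derivQuad G (W p) (A (e i))) (rotMeasure ν) :=
    integrable_finsetSum _ fun i _ => integrable_derivQuad_rotPath hG A B s θ _
  have key : ∫ p, inner ℝ (G (W p)) (c • (p.2.1 + B p.1) + (-σ) • A p.2.2) ∂(rotMeasure ν)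
      = c * (∫ p, inner ℝ (G (W p)) p.2.1 ∂(rotMeasure ν)
        - σ * ∫ p, ∫ y, derivQuad G (W p) y ∂ν ∂(rotMeasure ν)) := by
    have hQ : ∫ p, ∫ y, derivQuad G (W p) y ∂ν ∂(rotMeasure ν) =
        ∫ p, ∑ i, derivQuad G (W p) (A (e i)) ∂(rotMeasure ν)
          - ∫ p, ∑ i, derivQuad G (W p) (B (e i)) ∂(rotMeasure ν) := by
      rw [← integral_sub hiSA hiSB]
      congr 1
      ext p
      have := hcov (fderiv ℝ G (W p))
      simp only [derivQuad]
      linarith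
    have e1 : ∀ p : E × E × E, inner ℝ (G (W p)) (c • (p.2.1 + B p.1) + (-σ) • A p.2.2)
        = c * inner ℝ (G (W p)) p.2.1 + c * inner ℝ (G (W p)) (B p.1)
          - σ * inner ℝ (G (W p)) (A p.2.2) := fun p => by
      simp only [inner_add_right, inner_smul_right]; ring
    simp only [e1]
    rw [integral_sub (f := fun p : E × E × E => c * inner ℝ (G (W p)) p.2.1
        + c * inner ℝ (G (W p)) (B p.1)) ((hiX.const_mul c).add (hiB.const_mul c))
        (hiA.const_mul σ), integral_add (hiX.const_mul c) (hiB.const_mul c), integral_const_mul,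
      integral_const_mul, integral_const_mul, integral_inner_rotPath_fst hG hd A B h2 s θ,
      integral_inner_rotPath_snd hG hd A B h2 s θ, hQ]
    ring
  rw [key, abs_mul, abs_of_pos hc]
  have hAθ : ∀ v, (c • A) ((c⁻¹ • A') v) = v := fun v => by
    simp [hA, smul_smul, hc.ne']
  have hnorm : ‖c⁻¹ • A'‖ = c⁻¹ * ‖A'‖ := by
    rw [norm_smul, Real.norm_of_nonneg (inv_nonneg.2 hc.le)]
  suffices H : |∫ p, inner ℝ (G (W p)) p.2.1 ∂(rotMeasure ν)
        - σ * ∫ p, ∫ y, derivQuad G (W p) y ∂ν ∂(rotMeasure ν)|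
      ≤ 3 / 2 * σ ^ 2 * (M * ‖c⁻¹ • A'‖ * ∫ x, ‖x‖ ^ 3 ∂ν) by
    refine (mul_le_mul_of_nonneg_left H hc.le).trans (le_of_eq ?_)
    rw [hnorm]; field_simp
  have hW : ∀ z' x z, W (z', x, z) = (s + σ • B z') + σ • x + (c • A) z := fun z' x z => by
    simp only [W, rotPath, smul_add, smul_apply, σ, c]; abel
  unfold rotMeasure at hiX hiQ ⊢
  rw [integral_prod _ hiX, integral_prod _ hiQ, ← integral_const_mul,
    ← integral_sub hiX.integral_prod_left (hiQ.integral_prod_left.const_mul σ)]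
  have hb : ∀ᵐ z' ∂(stdGaussian E), ‖∫ q : E × E, inner ℝ (G (W (z', q))) q.1
        ∂(ν.prod (stdGaussian E))
      - σ * ∫ q : E × E, ∫ y, derivQuad G (W (z', q)) y ∂ν ∂(ν.prod (stdGaussian E))‖
      ≤ 3 / 2 * σ ^ 2 * (M * ‖c⁻¹ • A'‖ * ∫ x, ‖x‖ ^ 3 ∂ν) := by
    filter_upwards [hiX.prod_right_ae, hiQ.prod_right_ae] with z' hz hz2
    rw [integral_prod _ hz, integral_prod _ hz2]
    simp only [hW]
    simp only [← integral_smoothQuad hG _ _ h2]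
    exact abs_integral_inner_field_sub_integral_smoothQuad_le hG hd hAθ h3 hmean (s + σ • B z') hs
  simpa using norm_integral_le_of_norm_le_const hb

/-- **One-step comparison.** If `X` is centred and the covariance of `X + B Z'` is that of `A Z`
with `A` invertible, then `h(s + X + B Z')` and `h(s + A Z)` are close in mean. The equality of the
covariances is expressed through the associated traces against all operators `T`. The constant is
`∫ (3/2) sin² θ dθ` over `[0, π/2]`. -/
theorem abs_integral_sub_integral_gaussian_le (hh : Differentiable ℝ h)
    (hd : Differentiable ℝ (gradient h))
    (hG : LipschitzWith M (gradient h)) {A A' B : E →L[ℝ] E} (hA : ∀ v, A (A' v) = v)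
    (h3 : Integrable (fun x => ‖x‖ ^ 3) ν) (hmean : ∫ x, x ∂ν = 0)
    (hcov : ∀ T : E →L[ℝ] E, ∫ y, inner ℝ (T y) y ∂ν
      + ∑ i, inner ℝ (T (B (stdOrthonormalBasis ℝ E i))) (B (stdOrthonormalBasis ℝ E i))
      = ∑ i, inner ℝ (T (A (stdOrthonormalBasis ℝ E i))) (A (stdOrthonormalBasis ℝ E i)))
    (s : E) :
    |∫ x, ∫ z, h (s + x + B z) ∂(stdGaussian E) ∂ν - ∫ z, h (s + A z) ∂(stdGaussian E)|
      ≤ 3 * Real.pi / 8 * (M * ‖A'‖ * ∫ x, ‖x‖ ^ 3 ∂ν) := by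
  have h2 : Integrable (fun x => ‖x‖ ^ 2) ν := integrable_norm_pow_of_norm_cube h3 (by norm_num)
  set C : ℝ := M * ‖A'‖ * ∫ x, ‖x‖ ^ 3 ∂ν
  set ψ : ℝ → ℝ := fun θ => ∫ p, h (rotPath A B s θ p) ∂(rotMeasure ν)
  have hψ := hasDerivAt_integral_rotPath A B h2 hh hG s (ν := ν)
  have hψ0 : ψ 0 = ∫ z, h (s + A z) ∂(stdGaussian E) := by
    have hi := integrable_rotPath A B h2 hh hG s 0 (ν := ν)
    simp only [ψ]
    unfold rotMeasure at hi ⊢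
    rw [integral_prod _ hi]
    trans ∫ _ : E, (∫ z, h (s + A z) ∂(stdGaussian E)) ∂(stdGaussian E)
    · refine integral_congr_ae ?_
      filter_upwards [hi.prod_right_ae] with z' hz
      rw [integral_prod _ hz]
      simp [rotPath]
    · simp
  have hψ1 : ψ (Real.pi / 2) = ∫ x, ∫ z, h (s + x + B z) ∂(stdGaussian E) ∂ν := by
    have hi := integrable_rotPath A B h2 hh hG s (Real.pi / 2) (ν := ν)
    simp only [ψ]
    unfold rotMeasure at hi ⊢
    rw [integral_prod_symm _ hi, integral_prod _ hi.integral_prod_right]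
    simp [rotPath, add_assoc]
  -- `(t - sin t cos t) / 2` is a primitive of `sin² t`
  have hBd : ∀ t, HasDerivAt (fun t => 3 / 2 * C * ((t - Real.sin t * Real.cos t) / 2))
      (3 / 2 * Real.sin t ^ 2 * C) t := fun t => by
    refine ((((hasDerivAt_id t).fun_sub ((Real.hasDerivAt_sin t).mul
      (Real.hasDerivAt_cos t))).div_const 2).const_mul _).congr_deriv ?_
    have := Real.sin_sq_add_cos_sq t
    linear_combination (3 / 4) * C * (-this)
  have := image_norm_le_of_norm_deriv_right_le_deriv_boundary' (a := 0) (b := Real.pi / 2)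
    (f := fun t => ψ t - ψ 0)
    (fun t _ => ((hψ t).sub_const (ψ 0)).continuousAt.continuousWithinAt)
    (fun t _ => ((hψ t).sub_const (ψ 0)).hasDerivWithinAt) (by simp)
    (fun t _ => (hBd t).continuousAt.continuousWithinAt) (fun t _ => (hBd t).hasDerivWithinAt)
    (fun t ht => abs_deriv_rotPath_le hd hG hA h3 hmean hcov s
      (Real.sin_nonneg_of_nonneg_of_le_pi ht.1 (by linarith [ht.2, Real.pi_pos]))
      (Real.cos_pos_of_mem_Ioo ⟨by linarith [ht.1, Real.pi_pos], ht.2⟩))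
    (Set.right_mem_Icc.2 (by positivity))
  rw [hψ1, hψ0, Real.norm_eq_abs] at this
  refine this.trans (le_of_eq ?_)
  simp
  ring

end Interpolation

/-! ### Matrices and Gaussian means -/

section MatrixPart

variable {d : ℕ}

/-- The Borel structure on real square matrices. -/
instance instMeasurableSpaceMatrix : MeasurableSpace (Matrix (Fin d) (Fin d) ℝ) :=
  inferInstanceAs (MeasurableSpace (Fin d → Fin d → ℝ))

instance instBorelSpaceMatrix : BorelSpace (Matrix (Fin d) (Fin d) ℝ) :=
  inferInstanceAs (BorelSpace (Fin d → Fin d → ℝ))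

lemma measurable_of_entries {α : Type*} [MeasurableSpace α] {f : α → Matrix (Fin d) (Fin d) ℝ}
    (hf : ∀ i j, Measurable fun a => f a i j) : Measurable f :=
  measurable_pi_iff.2 fun i => measurable_pi_iff.2 fun j => hf i j

lemma isClosed_setOf_nonneg_matrix : IsClosed {A : Matrix (Fin d) (Fin d) ℝ | 0 ≤ A} := by
  have : {A : Matrix (Fin d) (Fin d) ℝ | 0 ≤ A} =
      {A | A.conjTranspose = A} ∩ ⋂ x : Fin d → ℝ, {A | 0 ≤ star x ⬝ᵥ A.mulVec x} := by
    ext A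
    simp only [Set.mem_ofPred_eq, Set.mem_inter_iff, Set.mem_iInter, Matrix.nonneg_iff_posSemidef,
      Matrix.posSemidef_iff_dotProduct_mulVec]
    rfl
  rw [this]
  exact (isClosed_eq (by fun_prop) continuous_id).inter
    (isClosed_iInter fun x => isClosed_le continuous_const (by fun_prop))

open scoped Matrix.Norms.L2Operator in
lemma continuousOn_sqrt_matrix :
    ContinuousOn (fun A : Matrix (Fin d) (Fin d) ℝ => CFC.sqrt A) {A | 0 ≤ A} :=
  CFC.continuousOn_sqrt

open Classical in
/-- The square root of matrices is continuous on the closed set of positive semidefinite matrices,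
and is zero elsewhere by convention. -/
lemma measurable_sqrt_matrix :
    Measurable (fun A : Matrix (Fin d) (Fin d) ℝ => CFC.sqrt A) := by
  have h := ContinuousOn.measurable_piecewise (g := fun _ => 0) continuousOn_sqrt_matrix
    continuousOn_const (isClosed_setOf_nonneg_matrix (d := d)).measurableSet
  convert h using 1
  ext1 A
  by_cases hA : 0 ≤ A
  · simp [Set.piecewise, hA]
  · simp [Set.piecewise, hA, CFC.sqrt_of_not_nonneg hA]

lemma continuous_toEuclideanCLM :
    Continuous (fun A : Matrix (Fin d) (Fin d) ℝ => Matrix.toEuclideanCLM (𝕜 := ℝ) A) :=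
  LinearMap.continuous_of_finiteDimensional
    (Matrix.toEuclideanCLM (n := Fin d) (𝕜 := ℝ)).toAlgEquiv.toLinearMap

lemma measurable_opNorm : Measurable (opNorm (d := d)) :=
  continuous_toEuclideanCLM.norm.measurable

lemma measurable_inv_matrix : Measurable (fun A : Matrix (Fin d) (Fin d) ℝ => A⁻¹) := by
  have h1 : Measurable (fun A : Matrix (Fin d) (Fin d) ℝ => A.det) :=
    (continuous_id.matrix_det).measurable
  have h2 : Measurable (fun A : Matrix (Fin d) (Fin d) ℝ => A.adjugate) :=
    (continuous_id.matrix_adjugate).measurable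
  refine measurable_of_entries fun i j => ?_
  simp only [Matrix.inv_def, Ring.inverse_eq_inv', Matrix.smul_apply, smul_eq_mul]
  exact h1.inv.mul (measurable_pi_iff.1 (measurable_pi_iff.1 h2 i) j)

lemma measurable_relInvNorm (S : Matrix (Fin d) (Fin d) ℝ) : Measurable (relInvNorm S) := by
  unfold relInvNorm
  refine Measurable.ite ?_ ?_ measurable_const
  · have : {P : Matrix (Fin d) (Fin d) ℝ | IsUnit P.det} = (fun P => P.det) ⁻¹' {0}ᶜ := by
      ext P; simp [isUnit_iff_ne_zero]
    rw [this]
    exact (continuous_id.matrix_det).measurable (measurableSet_singleton 0).compl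
  · refine (measurable_opNorm.comp (Measurable.comp (g := fun A : Matrix (Fin d) (Fin d) ℝ =>
      CFC.sqrt S * A * CFC.sqrt S) ?_ measurable_inv_matrix)).ennreal_ofReal
    exact Continuous.measurable (by fun_prop)

lemma opNorm_eq_zero_iff {A : Matrix (Fin d) (Fin d) ℝ} : opNorm A = 0 ↔ A = 0 := by
  simp [opNorm]

lemma opNorm_nonneg (A : Matrix (Fin d) (Fin d) ℝ) : 0 ≤ opNorm A := norm_nonneg _

/-- The mean of `h` under the normal law with mean `s` and covariance matrix `P`. -/
noncomputable def gaussSmooth (h : EuclideanSpace ℝ (Fin d) → ℝ) (s : EuclideanSpace ℝ (Fin d))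
    (P : Matrix (Fin d) (Fin d) ℝ) : ℝ :=
  ∫ z, h (s + Matrix.toEuclideanCLM (𝕜 := ℝ) (CFC.sqrt P) z)
    ∂(stdGaussian (EuclideanSpace ℝ (Fin d)))

lemma gaussSmooth_zero (h : EuclideanSpace ℝ (Fin d) → ℝ) (s : EuclideanSpace ℝ (Fin d)) :
    gaussSmooth h s 0 = h s := by
  simp [gaussSmooth]

lemma gaussSmooth_one (h : EuclideanSpace ℝ (Fin d) → ℝ) :
    gaussSmooth h 0 1 = ∫ z, h z ∂(stdGaussian (EuclideanSpace ℝ (Fin d))) := by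
  simp [gaussSmooth]

lemma measurable_gaussSmooth {h : EuclideanSpace ℝ (Fin d) → ℝ} (hh : Continuous h) :
    Measurable (fun p : EuclideanSpace ℝ (Fin d) × Matrix (Fin d) (Fin d) ℝ =>
      gaussSmooth h p.1 p.2) := by
  unfold gaussSmooth
  have hc : Continuous (fun q : (EuclideanSpace ℝ (Fin d) × Matrix (Fin d) (Fin d) ℝ) ×
      EuclideanSpace ℝ (Fin d) => h (q.1.1 + Matrix.toEuclideanCLM (𝕜 := ℝ) q.1.2 q.2)) :=
    hh.comp (continuous_fst.fst.add
      ((continuous_toEuclideanCLM.comp continuous_fst.snd).clm_apply continuous_snd))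
  have hm : Measurable (fun q : (EuclideanSpace ℝ (Fin d) × Matrix (Fin d) (Fin d) ℝ) ×
      EuclideanSpace ℝ (Fin d) => ((q.1.1, CFC.sqrt q.1.2), q.2)) :=
    ((measurable_fst.fst).prodMk (measurable_sqrt_matrix.comp measurable_fst.snd)).prodMk
      measurable_snd
  exact ((hc.measurable.comp hm).stronglyMeasurable.integral_prod_right'
    (ν := stdGaussian (EuclideanSpace ℝ (Fin d)))).measurable

lemma toEuclideanCLM_sqrt_isSelfAdjoint (P : Matrix (Fin d) (Fin d) ℝ) :
    IsSelfAdjoint (Matrix.toEuclideanCLM (𝕜 := ℝ) (CFC.sqrt P)) :=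
  (CFC.sqrt_nonneg P).isSelfAdjoint.map _

lemma toEuclideanCLM_sqrt_mul_self {P : Matrix (Fin d) (Fin d) ℝ} (hP : P.PosSemidef) :
    Matrix.toEuclideanCLM (𝕜 := ℝ) (CFC.sqrt P) * Matrix.toEuclideanCLM (𝕜 := ℝ) (CFC.sqrt P) =
      Matrix.toEuclideanCLM (𝕜 := ℝ) P := by
  rw [← map_mul, CFC.sqrt_mul_sqrt_self P hP.nonneg]

lemma inner_sqrt_sqrt {P : Matrix (Fin d) (Fin d) ℝ} (hP : P.PosSemidef)
    (x y : EuclideanSpace ℝ (Fin d)) :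
    inner ℝ (Matrix.toEuclideanCLM (𝕜 := ℝ) (CFC.sqrt P) x)
      (Matrix.toEuclideanCLM (𝕜 := ℝ) (CFC.sqrt P) y) =
    inner ℝ x (Matrix.toEuclideanCLM (𝕜 := ℝ) P y) := by
  rw [← toEuclideanCLM_sqrt_mul_self hP, ContinuousLinearMap.mul_def, ContinuousLinearMap.comp_apply]
  have := ContinuousLinearMap.adjoint_inner_left (Matrix.toEuclideanCLM (𝕜 := ℝ) (CFC.sqrt P))
    (Matrix.toEuclideanCLM (𝕜 := ℝ) (CFC.sqrt P) y) x
  rwa [(toEuclideanCLM_sqrt_isSelfAdjoint P).adjoint_eq] at this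

lemma inner_basisFun_toEuclideanCLM (P : Matrix (Fin d) (Fin d) ℝ) (j k : Fin d) :
    inner ℝ (EuclideanSpace.basisFun (Fin d) ℝ j)
      (Matrix.toEuclideanCLM (𝕜 := ℝ) P (EuclideanSpace.basisFun (Fin d) ℝ k)) = P j k := by
  rw [Matrix.inner_toEuclideanCLM]
  simp

/-- A quadratic form in coordinates. -/
lemma inner_apply_self_eq_sum (T : EuclideanSpace ℝ (Fin d) →L[ℝ] EuclideanSpace ℝ (Fin d))
    (u : EuclideanSpace ℝ (Fin d)) :
    inner ℝ (T u) u = ∑ j, ∑ k, inner ℝ (T (EuclideanSpace.basisFun (Fin d) ℝ j))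
      (EuclideanSpace.basisFun (Fin d) ℝ k) * (u j * u k) := by
  have hu : u = ∑ j, u j • EuclideanSpace.basisFun (Fin d) ℝ j := by
    simpa using ((EuclideanSpace.basisFun (Fin d) ℝ).sum_repr u).symm
  conv_lhs => rw [hu]
  simp only [map_sum, map_smul, sum_inner, inner_sum, inner_smul_left, inner_smul_right,
    conj_trivial, Finset.mul_sum]
  rw [Finset.sum_comm]
  refine Finset.sum_congr rfl fun j _ => Finset.sum_congr rfl fun k _ => by ring

/-- `E ⟨T G, G⟩ = ∑ T_{jk} P_{jk}` for `G = P^{1/2} Z`. -/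
lemma sum_inner_sqrt_eq {P : Matrix (Fin d) (Fin d) ℝ} (hP : P.PosSemidef)
    (T : EuclideanSpace ℝ (Fin d) →L[ℝ] EuclideanSpace ℝ (Fin d)) {ι : Type*} [Fintype ι]
    (e : OrthonormalBasis ι ℝ (EuclideanSpace ℝ (Fin d))) :
    ∑ i, inner ℝ (T (Matrix.toEuclideanCLM (𝕜 := ℝ) (CFC.sqrt P) (e i)))
        (Matrix.toEuclideanCLM (𝕜 := ℝ) (CFC.sqrt P) (e i)) =
      ∑ j, ∑ k, inner ℝ (T (EuclideanSpace.basisFun (Fin d) ℝ j))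
        (EuclideanSpace.basisFun (Fin d) ℝ k) * P j k := by
  set A := Matrix.toEuclideanCLM (𝕜 := ℝ) (CFC.sqrt P)
  set b := EuclideanSpace.basisFun (Fin d) ℝ
  have hco : ∀ i j, A (e i) j = inner ℝ (A (b j)) (e i) := fun i j => by
    rw [← ContinuousLinearMap.adjoint_inner_right, (toEuclideanCLM_sqrt_isSelfAdjoint P).adjoint_eq]
    simp [A, b, EuclideanSpace.inner_single_left]
  have hs : ∀ j k, ∑ i, A (e i) j * A (e i) k = P j k := fun j k => by
    simp only [hco]
    have := e.sum_inner_mul_inner (A (b j)) (A (b k))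
    rw [inner_sqrt_sqrt hP, inner_basisFun_toEuclideanCLM] at this
    rw [← this]
    exact Finset.sum_congr rfl fun i _ => by rw [real_inner_comm (A (b k))]
  simp only [inner_apply_self_eq_sum T (A _)]
  rw [Finset.sum_comm]
  refine Finset.sum_congr rfl fun j _ => ?_
  rw [Finset.sum_comm]
  refine Finset.sum_congr rfl fun k _ => ?_
  rw [← Finset.mul_sum, hs]

lemma isUnit_det_sqrt {P : Matrix (Fin d) (Fin d) ℝ} (hP : P.PosSemidef) (hdet : IsUnit P.det) :
    IsUnit (CFC.sqrt P).det := by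
  have h1 : (CFC.sqrt P).det * (CFC.sqrt P).det = P.det := by
    rw [← Matrix.det_mul, CFC.sqrt_mul_sqrt_self P hP.nonneg]
  exact isUnit_of_mul_isUnit_left (h1 ▸ hdet)

lemma norm_toEuclideanCLM_inv_sqrt {P : Matrix (Fin d) (Fin d) ℝ} (hP : P.PosSemidef) :
    ‖Matrix.toEuclideanCLM (𝕜 := ℝ) (CFC.sqrt P)⁻¹‖ = √(opNorm P⁻¹) := by
  have hsa : IsSelfAdjoint (CFC.sqrt P)⁻¹ := by
    have : IsSelfAdjoint (CFC.sqrt P) := (CFC.sqrt_nonneg P).isSelfAdjoint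
    rw [← Matrix.isHermitian_iff_isSelfAdjoint] at this ⊢
    exact this.inv
  have hsa' : IsSelfAdjoint (Matrix.toEuclideanCLM (𝕜 := ℝ) (CFC.sqrt P)⁻¹) := hsa.map _
  have h := CStarRing.norm_star_mul_self (x := Matrix.toEuclideanCLM (𝕜 := ℝ) (CFC.sqrt P)⁻¹)
  rw [hsa'.star_eq, ← map_mul, ← Matrix.mul_inv_rev, CFC.sqrt_mul_sqrt_self P hP.nonneg] at h
  rw [opNorm, h, Real.sqrt_mul_self (norm_nonneg _)]

end MatrixPart

/-! ### The comparison for one martingale difference -/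

section ConditionalStep

open scoped NNReal

variable {d : ℕ}

lemma relInvNorm_of_not_isUnit (S : Matrix (Fin d) (Fin d) ℝ) {P : Matrix (Fin d) (Fin d) ℝ}
    (hP : ¬IsUnit P.det) : relInvNorm S P = ∞ := by
  rw [relInvNorm, if_neg hP]

lemma relInvNorm_one {P : Matrix (Fin d) (Fin d) ℝ} (hP : IsUnit P.det) :
    relInvNorm 1 P = ENNReal.ofReal (opNorm P⁻¹) := by
  simp only [relInvNorm, if_pos hP, CFC.sqrt_one, one_mul, mul_one]

lemma relInvNorm_one_ne_zero (hd : d ≠ 0) (P : Matrix (Fin d) (Fin d) ℝ) :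
    relInvNorm 1 P ≠ 0 := by
  by_cases hP : IsUnit P.det
  · rw [relInvNorm_one hP, ENNReal.ofReal_ne_zero_iff]
    refine (opNorm_nonneg _).lt_of_ne' fun h => ?_
    have : Nonempty (Fin d) := ⟨⟨0, Nat.pos_of_ne_zero hd⟩⟩
    have h1 := Matrix.mul_nonsing_inv P hP
    rw [opNorm_eq_zero_iff.1 h, mul_zero] at h1
    exact zero_ne_one h1
  · simp [relInvNorm_of_not_isUnit 1 hP]

variable {h : EuclideanSpace ℝ (Fin d) → ℝ} {M : ℝ≥0}

lemma integrable_apply_mul_apply {ν : Measure (EuclideanSpace ℝ (Fin d))}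
    (h2 : Integrable (fun x => ‖x‖ ^ 2) ν) (i j : Fin d) :
    Integrable (fun x : EuclideanSpace ℝ (Fin d) => x i * x j) ν := by
  refine h2.mono' (by fun_prop) (.of_forall fun x => ?_)
  rw [norm_mul, sq]
  exact mul_le_mul (PiLp.norm_apply_le x i) (PiLp.norm_apply_le x j) (norm_nonneg _)
    (norm_nonneg _)

/-- One-step comparison in terms of covariance matrices, for a centred law `ν` with second moments
`P - Q`. If `P` is singular, then the right-hand side is infinite unless `ν` is the Dirac mass
at `0`, in which case the left-hand side is zero. -/
lemma ofReal_abs_integral_gaussSmooth_sub_le (hh : Differentiable ℝ h)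
    (hd : Differentiable ℝ (gradient h)) (hG : LipschitzWith M (gradient h)) (hM : M ≠ 0)
    {ν : Measure (EuclideanSpace ℝ (Fin d))} [IsProbabilityMeasure ν]
    (h2 : Integrable (fun x => ‖x‖ ^ 2) ν) (hmean : ∫ x, x ∂ν = 0)
    {P Q : Matrix (Fin d) (Fin d) ℝ} (hP : P.PosSemidef) (hQ : Q.PosSemidef)
    (hcov : ∀ i j, ∫ x, x i * x j ∂ν = P i j - Q i j) (s : EuclideanSpace ℝ (Fin d)) :
    ENNReal.ofReal |∫ x, gaussSmooth h (s + x) Q ∂ν - gaussSmooth h s P| ≤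
      ENNReal.ofReal (3 * Real.pi / 8) * M *
        ∫⁻ x, relInvNorm 1 P ^ (1 / 2 : ℝ) * ENNReal.ofReal (‖x‖ ^ 3) ∂ν := by
  have hm3 : Measurable (fun x : EuclideanSpace ℝ (Fin d) => ENNReal.ofReal (‖x‖ ^ 3)) := by
    fun_prop
  have hpos : ENNReal.ofReal (3 * Real.pi / 8) * (M : ℝ≥0∞) ≠ 0 :=
    mul_ne_zero (by rw [ENNReal.ofReal_ne_zero_iff]; positivity) (by exact_mod_cast hM)
  rw [lintegral_const_mul _ hm3]
  by_cases hdet : IsUnit P.det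
  swap
  · rw [relInvNorm_of_not_isUnit 1 hdet, ENNReal.top_rpow_of_pos (by norm_num)]
    by_cases h0 : ∫⁻ x, ENNReal.ofReal (‖x‖ ^ 3) ∂ν = 0
    · -- here the increment vanishes, so that the two covariance matrices agree
      rw [lintegral_eq_zero_iff hm3] at h0
      have hx : ∀ᵐ x ∂ν, x = 0 := by
        filter_upwards [h0] with x hx
        simpa using hx
      have hPQ : P = Q := by
        ext i j
        have h1 := hcov i j
        rw [integral_congr_ae (g := fun _ => (0 : ℝ))
          (by filter_upwards [hx] with x hx; simp [hx]), integral_zero] at h1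
        linarith
      have h1 : ∫ x, gaussSmooth h (s + x) Q ∂ν = gaussSmooth h s P := by
        rw [integral_congr_ae (g := fun _ => gaussSmooth h s P)
          (by filter_upwards [hx] with x hx; simp [hx, hPQ])]
        simp
      simp [h1]
    · rw [ENNReal.top_mul h0, ENNReal.mul_top hpos]
      exact le_top
  by_cases h3 : Integrable (fun x => ‖x‖ ^ 3) ν
  swap
  · -- an infinite third moment is possible only for `d ≠ 0`, and then the bound is infinite
    have hd0 : d ≠ 0 := by
      rintro rfl
      refine h3 ((integrable_zero _ ℝ ν).congr (.of_forall fun x => ?_))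
      simp [Subsingleton.elim x 0]
    have h0 : ∫⁻ x, ENNReal.ofReal (‖x‖ ^ 3) ∂ν = ∞ := by
      by_contra hne
      exact h3 ((lintegral_ofReal_ne_top_iff_integrable (by fun_prop)
        (.of_forall fun x => by positivity)).1 hne)
    rw [h0, ENNReal.mul_top, ENNReal.mul_top hpos]
    · exact le_top
    · have := relInvNorm_one_ne_zero hd0 P
      rw [Ne, ENNReal.rpow_eq_zero_iff]
      norm_num [this]
  set A := Matrix.toEuclideanCLM (𝕜 := ℝ) (CFC.sqrt P)
  set A' := Matrix.toEuclideanCLM (𝕜 := ℝ) (CFC.sqrt P)⁻¹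
  have hA : ∀ v, A (A' v) = v := fun v => by
    have h1 : A * A' = 1 := by
      simp only [A, A']
      rw [← map_mul, Matrix.mul_nonsing_inv _ (isUnit_det_sqrt hP hdet), map_one]
    simpa using congrArg (fun T => T v) h1
  have hi := integrable_apply_mul_apply h2
  have key := abs_integral_sub_integral_gaussian_le (ν := ν) hh hd hG
    (A := A) (A' := A') (B := Matrix.toEuclideanCLM (𝕜 := ℝ) (CFC.sqrt Q)) hA h3 hmean
    (fun T => by
      rw [sum_inner_sqrt_eq hP, sum_inner_sqrt_eq hQ]
      simp only [inner_apply_self_eq_sum T]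
      rw [integral_finsetSum _ fun j _ => integrable_finsetSum _ fun k _ => (hi j k).const_mul _,
        ← Finset.sum_add_distrib]
      refine Finset.sum_congr rfl fun j _ => ?_
      rw [integral_finsetSum _ fun k _ => (hi j k).const_mul _, ← Finset.sum_add_distrib]
      refine Finset.sum_congr rfl fun k _ => ?_
      rw [integral_const_mul, hcov]
      ring) s
  refine (ENNReal.ofReal_le_ofReal key).trans (le_of_eq ?_)
  rw [norm_toEuclideanCLM_inv_sqrt hP, relInvNorm_one hdet,
    ← ofReal_integral_eq_lintegral_ofReal h3 (.of_forall fun x => by positivity),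
    ENNReal.ofReal_rpow_of_nonneg (opNorm_nonneg _) (by norm_num), ← Real.sqrt_eq_rpow,
    ← ENNReal.ofReal_mul (Real.sqrt_nonneg _), ENNReal.ofReal_mul (by positivity), mul_assoc,
    mul_assoc, ENNReal.ofReal_mul M.coe_nonneg, ENNReal.ofReal_coe_nnreal]

/-- The second moments of a law form a positive semidefinite matrix. -/
lemma posSemidef_of_second_moments {ν : Measure (EuclideanSpace ℝ (Fin d))}
    (h2 : Integrable (fun x => ‖x‖ ^ 2) ν) {V : Matrix (Fin d) (Fin d) ℝ}
    (hV : ∀ i j, V i j = ∫ x, x i * x j ∂ν) : V.PosSemidef := by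
  have hi := integrable_apply_mul_apply h2
  rw [Matrix.posSemidef_iff_dotProduct_mulVec]
  refine ⟨?_, fun u => ?_⟩
  · ext i j
    simp [hV, mul_comm]
  · have : star u ⬝ᵥ V.mulVec u = ∫ x, (∑ i, u i * x i) ^ 2 ∂ν := by
      have e : ∀ x : EuclideanSpace ℝ (Fin d), (∑ i, u i * x i) ^ 2 =
          ∑ i, ∑ j, u i * u j * (x i * x j) := fun x => by
        rw [sq, Finset.sum_mul_sum]
        exact Finset.sum_congr rfl fun i _ => Finset.sum_congr rfl fun j _ => by ring
      simp only [e]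
      rw [integral_finsetSum _ fun i _ => integrable_finsetSum _ fun j _ => (hi i j).const_mul _]
      simp only [dotProduct, Matrix.mulVec, hV, Finset.mul_sum]
      refine Finset.sum_congr rfl fun i _ => ?_
      rw [integral_finsetSum _ fun j _ => (hi i j).const_mul _]
      refine Finset.sum_congr rfl fun j _ => ?_
      rw [integral_const_mul, star_trivial]
      ring
    rw [this]
    exact integral_nonneg fun x => sq_nonneg _

variable {Ω β : Type*} {mΩ : MeasurableSpace Ω} {mβ : MeasurableSpace β} {μ : Measure Ω}
  {π : Ω → β} {Y : Ω → EuclideanSpace ℝ (Fin d)}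

lemma integrable_mul_apply_of_memLp (hY : MemLp Y 2 μ) (i j : Fin d) :
    Integrable (fun ω => Y ω i * Y ω j) μ := by
  have h : ∀ i, MemLp (fun ω => Y ω i) 2 μ := fun i =>
    ((EuclideanSpace.proj (𝕜 := ℝ) i : EuclideanSpace ℝ (Fin d) →L[ℝ] ℝ)).comp_memLp' hY
  exact MemLp.integrable_mul (p := 2) (q := 2) (h i) (h j)

variable [IsProbabilityMeasure μ]

lemma ae_integrable_norm_sq_condDistrib (hπ : Measurable π) (hY : MemLp Y 2 μ) :
    ∀ᵐ ω ∂μ, Integrable (fun y => ‖y‖ ^ 2) (condDistrib Y π μ (π ω)) := by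
  have hYm : AEMeasurable Y μ := hY.1.aemeasurable
  have : Integrable (fun p : β × EuclideanSpace ℝ (Fin d) => ‖p.2‖ ^ 2)
      (μ.map fun a => (π a, Y a)) := by
    rw [integrable_map_measure (by fun_prop) (hπ.aemeasurable.prodMk hYm)]
    exact hY.integrable_norm_pow (p := 2) (by norm_num)
  exact this.condDistrib_ae hπ.aemeasurable hYm

lemma condExp_mul_ae_eq_integral_condDistrib (hπ : Measurable π) (hY : MemLp Y 2 μ) (i j : Fin d) :
    μ[fun ω => Y ω i * Y ω j | mβ.comap π] =ᵐ[μ]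
      fun ω => ∫ y, y i * y j ∂(condDistrib Y π μ (π ω)) :=
  condExp_ae_eq_integral_condDistrib (f := fun y : EuclideanSpace ℝ (Fin d) => y i * y j) hπ
    hY.1.aemeasurable (Measurable.stronglyMeasurable (by fun_prop))
    (integrable_mul_apply_of_memLp hY i j)

lemma IsCondSecondMoment.ae_posSemidef_comap {V : Ω → Matrix (Fin d) (Fin d) ℝ}
    (hπ : Measurable π) (hY : MemLp Y 2 μ) (hV : IsCondSecondMoment (mβ.comap π) V Y μ) :
    ∀ᵐ ω ∂μ, (V ω).PosSemidef := by
  have h1 : ∀ᵐ ω ∂μ, ∀ i j, V ω i j = ∫ y, y i * y j ∂(condDistrib Y π μ (π ω)) := by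
    simp only [ae_all_iff]
    intro i j
    exact (hV i j).trans (condExp_mul_ae_eq_integral_condDistrib hπ hY i j)
  filter_upwards [h1, ae_integrable_norm_sq_condDistrib hπ hY] with ω h h2
  exact posSemidef_of_second_moments h2 h

/-- A conditional second moment matrix is almost surely positive semidefinite. -/
lemma IsCondSecondMoment.ae_posSemidef {𝒢 : MeasurableSpace Ω} (h𝒢 : 𝒢 ≤ mΩ)
    {V : Ω → Matrix (Fin d) (Fin d) ℝ} (hY : MemLp Y 2 μ) (hV : IsCondSecondMoment 𝒢 V Y μ) :
    ∀ᵐ ω ∂μ, (V ω).PosSemidef := by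
  refine IsCondSecondMoment.ae_posSemidef_comap (mβ := 𝒢) (π := id) (fun s hs => h𝒢 s hs) hY ?_
  rwa [MeasurableSpace.comap_id]

/-- The one-step comparison under conditioning on the value of `π`, obtained by applying the
unconditional comparison to the conditional law of `Y` given `π`. -/
lemma ofReal_abs_integral_gaussSmooth_sub_le_of_condExp_comap (hh : Differentiable ℝ h)
    (hd : Differentiable ℝ (gradient h)) (hG : LipschitzWith M (gradient h)) (hM : M ≠ 0)
    (hπ : Measurable π) (hY : MemLp Y 2 μ)
    (hmean : μ[Y | mβ.comap π] =ᵐ[μ] 0)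
    {s : β → EuclideanSpace ℝ (Fin d)} {P Q : β → Matrix (Fin d) (Fin d) ℝ}
    (hs : Measurable s) (hP : Measurable P) (hQ : Measurable Q)
    (hPpos : ∀ᵐ ω ∂μ, (P (π ω)).PosSemidef) (hQpos : ∀ᵐ ω ∂μ, (Q (π ω)).PosSemidef)
    (hcov : IsCondSecondMoment (mβ.comap π) (fun ω => P (π ω) - Q (π ω)) Y μ)
    (hi1 : Integrable (fun ω => gaussSmooth h (s (π ω) + Y ω) (Q (π ω))) μ)
    (hi2 : Integrable (fun ω => gaussSmooth h (s (π ω)) (P (π ω))) μ) :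
    ENNReal.ofReal |∫ ω, gaussSmooth h (s (π ω) + Y ω) (Q (π ω)) ∂μ
        - ∫ ω, gaussSmooth h (s (π ω)) (P (π ω)) ∂μ| ≤
      ENNReal.ofReal (3 * Real.pi / 8) * M *
        ∫⁻ ω, relInvNorm 1 (P (π ω)) ^ (1 / 2 : ℝ) * ENNReal.ofReal (‖Y ω‖ ^ 3) ∂μ := by
  have hYm : AEMeasurable Y μ := hY.1.aemeasurable
  -- for almost every `ω`, the law `κ (π ω)` is centred with second moments `P (π ω) - Q (π ω)`
  set κ := condDistrib Y π μ
  have hUm := measurable_gaussSmooth hh.continuous (d := d)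
  have hfm : StronglyMeasurable (fun p : β × EuclideanSpace ℝ (Fin d) =>
      gaussSmooth h (s p.1 + p.2) (Q p.1)) :=
    (hUm.comp (((hs.comp measurable_fst).add measurable_snd).prodMk
      (hQ.comp measurable_fst))).stronglyMeasurable
  have hc := condExp_prod_ae_eq_integral_condDistrib hπ hYm hfm hi1
  have hi3 : Integrable (fun ω => ∫ y, gaussSmooth h (s (π ω) + y) (Q (π ω)) ∂(κ (π ω))) μ :=
    integrable_condExp.congr hc
  have e1 : ∫ ω, gaussSmooth h (s (π ω) + Y ω) (Q (π ω)) ∂μ =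
      ∫ ω, ∫ y, gaussSmooth h (s (π ω) + y) (Q (π ω)) ∂(κ (π ω)) ∂μ := by
    rw [← integral_condExp hπ.comap_le]
    exact integral_congr_ae hc
  rw [e1, ← integral_sub hi3 hi2]
  have hmean' : ∀ᵐ ω ∂μ, ∫ y, y ∂(κ (π ω)) = 0 := by
    filter_upwards [condExp_ae_eq_integral_condDistrib' hπ (hY.integrable one_le_two), hmean]
      with ω h1 h2
    rw [← h1, h2, Pi.zero_apply]
  have hcov' : ∀ᵐ ω ∂μ, ∀ i j, ∫ y, y i * y j ∂(κ (π ω)) = P (π ω) i j - Q (π ω) i j := by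
    simp only [ae_all_iff]
    intro i j
    filter_upwards [hcov i j, condExp_mul_ae_eq_integral_condDistrib hπ hY i j] with ω h1 h2
    rw [← h2, ← h1]; rfl
  have hgm : Measurable (fun p : β × EuclideanSpace ℝ (Fin d) =>
      relInvNorm 1 (P p.1) ^ (1 / 2 : ℝ) * ENNReal.ofReal (‖p.2‖ ^ 3)) :=
    (((measurable_relInvNorm 1).comp (hP.comp measurable_fst)).pow_const _).mul (by fun_prop)
  calc ENNReal.ofReal |∫ ω, (∫ y, gaussSmooth h (s (π ω) + y) (Q (π ω)) ∂(κ (π ω))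
          - gaussSmooth h (s (π ω)) (P (π ω))) ∂μ|
      ≤ ∫⁻ ω, ENNReal.ofReal |∫ y, gaussSmooth h (s (π ω) + y) (Q (π ω)) ∂(κ (π ω))
          - gaussSmooth h (s (π ω)) (P (π ω))| ∂μ := by
        refine (ENNReal.ofReal_le_ofReal (norm_integral_le_lintegral_norm (G := ℝ) _)).trans ?_
        exact ENNReal.ofReal_toReal_le
    _ ≤ ∫⁻ ω, ENNReal.ofReal (3 * Real.pi / 8) * M *
          ∫⁻ y, relInvNorm 1 (P (π ω)) ^ (1 / 2 : ℝ) * ENNReal.ofReal (‖y‖ ^ 3) ∂(κ (π ω)) ∂μ := by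
        refine lintegral_mono_ae ?_
        filter_upwards [hmean', hcov', hPpos, hQpos, ae_integrable_norm_sq_condDistrib hπ hY]
          with ω h1 h2 h3 h4 h5
        exact ofReal_abs_integral_gaussSmooth_sub_le hh hd hG hM h5 h1 h3 h4 h2 _
    _ = ENNReal.ofReal (3 * Real.pi / 8) * M *
        ∫⁻ ω, relInvNorm 1 (P (π ω)) ^ (1 / 2 : ℝ) * ENNReal.ofReal (‖Y ω‖ ^ 3) ∂μ := by
        have hin : Measurable (fun b => ∫⁻ y, relInvNorm 1 (P b) ^ (1 / 2 : ℝ) *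
            ENNReal.ofReal (‖y‖ ^ 3) ∂(κ b)) := hgm.lintegral_kernel_prod_right
        rw [lintegral_const_mul (f := fun ω => ∫⁻ y, relInvNorm 1 (P (π ω)) ^ (1 / 2 : ℝ) *
            ENNReal.ofReal (‖y‖ ^ 3) ∂(κ (π ω))) _ (hin.comp hπ)]
        congr 1
        rw [← lintegral_map (f := fun b => ∫⁻ y, relInvNorm 1 (P b) ^ (1 / 2 : ℝ) *
            ENNReal.ofReal (‖y‖ ^ 3) ∂(κ b)) hin hπ, ← Measure.lintegral_compProd hgm,
          compProd_map_condDistrib hYm, lintegral_map' hgm.aemeasurable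
            (hπ.aemeasurable.prodMk hYm)]

/-- The one-step comparison under conditioning on a sub-σ-algebra `𝒢`, which is generated by the
identity map from `Ω` to the measurable space `(Ω, 𝒢)`. -/
lemma ofReal_abs_integral_gaussSmooth_sub_le_of_condExp (hh : Differentiable ℝ h)
    (hd : Differentiable ℝ (gradient h)) (hG : LipschitzWith M (gradient h)) (hM : M ≠ 0)
    {𝒢 : MeasurableSpace Ω} (h𝒢 : 𝒢 ≤ mΩ) (hY : MemLp Y 2 μ) (hmean : μ[Y | 𝒢] =ᵐ[μ] 0)
    {s : Ω → EuclideanSpace ℝ (Fin d)} {P Q : Ω → Matrix (Fin d) (Fin d) ℝ}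
    (hs : Measurable[𝒢] s) (hP : Measurable[𝒢] P) (hQ : Measurable[𝒢] Q)
    (hPpos : ∀ᵐ ω ∂μ, (P ω).PosSemidef) (hQpos : ∀ᵐ ω ∂μ, (Q ω).PosSemidef)
    (hcov : IsCondSecondMoment 𝒢 (fun ω => P ω - Q ω) Y μ)
    (hi1 : Integrable (fun ω => gaussSmooth h (s ω + Y ω) (Q ω)) μ)
    (hi2 : Integrable (fun ω => gaussSmooth h (s ω) (P ω)) μ) :
    ENNReal.ofReal |∫ ω, gaussSmooth h (s ω + Y ω) (Q ω) ∂μ - ∫ ω, gaussSmooth h (s ω) (P ω) ∂μ| ≤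
      ENNReal.ofReal (3 * Real.pi / 8) * M *
        ∫⁻ ω, relInvNorm 1 (P ω) ^ (1 / 2 : ℝ) * ENNReal.ofReal (‖Y ω‖ ^ 3) ∂μ :=
  ofReal_abs_integral_gaussSmooth_sub_le_of_condExp_comap (mβ := 𝒢) (π := id) hh hd hG hM
    (fun s hs => h𝒢 s hs) hY (by rwa [MeasurableSpace.comap_id]) hs hP hQ hPpos hQpos
    (by rwa [MeasurableSpace.comap_id]) hi1 hi2

end ConditionalStep

/-! ### Martingales with total covariance the identity -/

section Telescoping

open scoped NNReal

lemma ofReal_abs_sub_le_sum (T : ℕ → ℝ) (f : ℕ → ℝ≥0∞) (c : ℝ≥0∞) (n : ℕ)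
    (hT : ∀ k < n, ENNReal.ofReal |T (k + 1) - T k| ≤ c * f (k + 1)) :
    ENNReal.ofReal |T n - T 0| ≤ c * ∑ k ∈ Finset.Icc 1 n, f k := by
  induction n with
  | zero => simp
  | succ n ih =>
    rw [Finset.sum_Icc_succ_top (Nat.le_add_left 1 n), mul_add]
    refine le_trans ?_ (add_le_add (ih fun k hk => hT k (by omega)) (hT n (by omega)))
    rw [← ENNReal.ofReal_add (abs_nonneg _) (abs_nonneg _)]
    refine ENNReal.ofReal_le_ofReal ?_
    linarith [abs_sub_le (T (n + 1)) (T n) (T 0)]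

variable {d : ℕ} {h : EuclideanSpace ℝ (Fin d) → ℝ} {M : ℝ≥0}

lemma abs_le_add_mul_sq_of_lipschitz_gradient (hh : Differentiable ℝ h)
    (hG : LipschitzWith M (gradient h)) (x : EuclideanSpace ℝ (Fin d)) :
    |h x| ≤ (|h 0| + ‖gradient h 0‖) + (‖gradient h 0‖ + M) * ‖x‖ ^ 2 := by
  refine (abs_le_of_lipschitz_gradient hh hG x).trans ?_
  have h1 : ‖x‖ ≤ 1 + ‖x‖ ^ 2 := by nlinarith [sq_nonneg (‖x‖ - 1)]
  have := mul_le_mul_of_nonneg_left h1 (norm_nonneg (gradient h 0))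
  nlinarith

lemma integrable_stdGaussian_of_lipschitz_gradient (hh : Differentiable ℝ h)
    (hG : LipschitzWith M (gradient h)) :
    Integrable h (stdGaussian (EuclideanSpace ℝ (Fin d))) := by
  have h2 : Integrable (fun z : EuclideanSpace ℝ (Fin d) => ‖z‖ ^ 2) (stdGaussian _) :=
    IsGaussian.memLp_two_id.integrable_norm_pow (p := 2) (by norm_num)
  exact Integrable.mono' ((integrable_const _).add (h2.const_mul _))
    hh.continuous.aestronglyMeasurable
    (.of_forall (abs_le_add_mul_sq_of_lipschitz_gradient hh hG))

/-- If `0 ≤ P ≤ 1`, then `P^{1/2}` is a contraction. -/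
lemma norm_toEuclideanCLM_sqrt_apply_le {P : Matrix (Fin d) (Fin d) ℝ} (hP : P.PosSemidef)
    (hP1 : (1 - P).PosSemidef) (z : EuclideanSpace ℝ (Fin d)) :
    ‖Matrix.toEuclideanCLM (𝕜 := ℝ) (CFC.sqrt P) z‖ ≤ ‖z‖ := by
  refine le_of_sq_le_sq ?_ (norm_nonneg z)
  rw [← real_inner_self_eq_norm_sq, ← real_inner_self_eq_norm_sq, inner_sqrt_sqrt hP]
  have h1 := hP1.dotProduct_mulVec_nonneg (x := z.ofLp)
  rw [star_trivial, ← Matrix.inner_toEuclideanCLM, map_sub, map_one] at h1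
  simpa [inner_sub_right] using h1

lemma abs_gaussSmooth_le (hh : Differentiable ℝ h) (hG : LipschitzWith M (gradient h))
    {P : Matrix (Fin d) (Fin d) ℝ} (hP : P.PosSemidef) (hP1 : (1 - P).PosSemidef)
    (s : EuclideanSpace ℝ (Fin d)) :
    |gaussSmooth h s P| ≤ (|h 0| + ‖gradient h 0‖) + (‖gradient h 0‖ + M) *
      (2 * ‖s‖ ^ 2 + 2 * ∫ z, ‖z‖ ^ 2 ∂(stdGaussian (EuclideanSpace ℝ (Fin d)))) := by
  have h2 : Integrable (fun z : EuclideanSpace ℝ (Fin d) => ‖z‖ ^ 2) (stdGaussian _) :=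
    IsGaussian.memLp_two_id.integrable_norm_pow (p := 2) (by norm_num)
  have hi : Integrable (fun z : EuclideanSpace ℝ (Fin d) => 2 * ‖s‖ ^ 2 + 2 * ‖z‖ ^ 2)
      (stdGaussian _) := (integrable_const _).add (h2.const_mul 2)
  refine (norm_integral_le_of_norm_le (G := ℝ) (g := fun z => (|h 0| + ‖gradient h 0‖)
      + (‖gradient h 0‖ + M) * (2 * ‖s‖ ^ 2 + 2 * ‖z‖ ^ 2))
      ((integrable_const _).add (hi.const_mul _))
      (.of_forall fun z => ?_)).trans (le_of_eq ?_)
  · refine (abs_le_add_mul_sq_of_lipschitz_gradient hh hG _).trans ?_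
    gcongr
    have h3 := norm_add_le s (Matrix.toEuclideanCLM (𝕜 := ℝ) (CFC.sqrt P) z)
    have h4 := norm_toEuclideanCLM_sqrt_apply_le hP hP1 z
    have h5 := pow_le_pow_left₀ (norm_nonneg _) (h3.trans (add_le_add le_rfl h4)) 2
    nlinarith [sq_nonneg (‖s‖ - ‖z‖)]
  · rw [integral_add (integrable_const _) (hi.const_mul _), integral_const_mul,
      integral_add (integrable_const _) (h2.const_mul 2)]
    simp [integral_const_mul]

variable {Ω : Type*} {mΩ : MeasurableSpace Ω} {μ : Measure Ω}

lemma integrable_gaussSmooth [IsProbabilityMeasure μ] (hh : Differentiable ℝ h)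
    (hG : LipschitzWith M (gradient h)) {s : Ω → EuclideanSpace ℝ (Fin d)}
    {P : Ω → Matrix (Fin d) (Fin d) ℝ} (hs : MemLp s 2 μ) (hPm : AEMeasurable P μ)
    (hP : ∀ᵐ ω ∂μ, (P ω).PosSemidef ∧ (1 - P ω).PosSemidef) :
    Integrable (fun ω => gaussSmooth h (s ω) (P ω)) μ := by
  have hs2 : Integrable (fun ω => ‖s ω‖ ^ 2) μ := hs.integrable_norm_pow (p := 2) (by norm_num)
  refine Integrable.mono' (g := fun ω => (|h 0| + ‖gradient h 0‖) + (‖gradient h 0‖ + M) *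
      (2 * ‖s ω‖ ^ 2 + 2 * ∫ z, ‖z‖ ^ 2 ∂(stdGaussian (EuclideanSpace ℝ (Fin d)))))
    ((integrable_const _).add (((hs2.const_mul 2).add (integrable_const _)).const_mul _))
    ((measurable_gaussSmooth hh.continuous).comp_aemeasurable
      (hs.1.aemeasurable.prodMk hPm)).aestronglyMeasurable ?_
  filter_upwards [hP] with ω hω
  exact abs_gaussSmooth_le hh hG hω.1 hω.2 _

variable {n : ℕ} {ℱ : Filtration ℕ mΩ} {Y : ℕ → Ω → EuclideanSpace ℝ (Fin d)}
  {W : ℕ → Ω → Matrix (Fin d) (Fin d) ℝ}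

lemma partialSum_succ (k : ℕ) (ω : Ω) :
    partialSum (k + 1) Y ω = partialSum k Y ω + Y (k + 1) ω := by
  simp [partialSum, Finset.sum_Icc_succ_top]

lemma memLp_partialSum (hY2 : ∀ k ∈ Finset.Icc 1 n, MemLp (Y k) 2 μ) {k : ℕ} (hk : k ≤ n) :
    MemLp (partialSum k Y) 2 μ :=
  memLp_finsetSum _ fun i hi => hY2 i (Finset.Icc_subset_Icc le_rfl hk hi)

lemma measurable_partialSum (hY : IsMartingaleDifference n Y ℱ μ) {k : ℕ} (hk : k ≤ n) :
    Measurable[ℱ k] (partialSum k Y) := by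
  refine Finset.measurable_sum _ fun i hi => ?_
  exact ((hY.adapted i (Finset.Icc_subset_Icc le_rfl hk hi)).mono
    (ℱ.mono (Finset.mem_Icc.1 hi).2)).measurable

lemma integral_partialSum_eq_zero [IsProbabilityMeasure μ] (hY : IsMartingaleDifference n Y ℱ μ) :
    ∫ ω, partialSum n Y ω ∂μ = 0 := by
  unfold partialSum
  rw [integral_finsetSum _ fun i hi => hY.integrable i hi]
  refine Finset.sum_eq_zero fun i hi => ?_
  rw [← integral_condExp (ℱ.le (i - 1)), integral_congr_ae (hY.condExp_eq_zero i hi)]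
  simp

variable (μ ℱ Y) in
/-- The `ℱ (k - 1)`-measurable version of the conditional second moment of `Y k`. -/
noncomputable def condSecondMoment (k : ℕ) (ω : Ω) : Matrix (Fin d) (Fin d) ℝ :=
  Matrix.of fun i j => (μ[fun ω => Y k ω i * Y k ω j | ℱ (k - 1)]) ω

variable (μ ℱ Y) in
/-- The version `1 - (V_1 + ⋯ + V_k)` of the remaining conditional covariance `P_{k+1}`, in the
case `P_1 = 1`; in contrast to `V_{k+1} + ⋯ + V_n`, it is predictable. -/
noncomputable def remainingCov (k : ℕ) (ω : Ω) : Matrix (Fin d) (Fin d) ℝ :=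
  1 - ∑ i ∈ Finset.Icc 1 k, condSecondMoment μ ℱ Y i ω

lemma isCondSecondMoment_condSecondMoment (k : ℕ) :
    IsCondSecondMoment (ℱ (k - 1)) (condSecondMoment μ ℱ Y k) (Y k) μ :=
  fun _ _ => Filter.EventuallyEq.rfl

/-- Predictability: `remainingCov k` is measurable with respect to `ℱ (k - 1)`. -/
lemma measurable_remainingCov {k j : ℕ} (hkj : k ≤ j + 1) :
    Measurable[ℱ j] (remainingCov μ ℱ Y k) := by
  refine @measurable_of_entries _ _ (ℱ j) _ fun a b => ?_
  simp only [remainingCov, Matrix.sub_apply, Matrix.sum_apply, condSecondMoment, Matrix.of_apply]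
  refine measurable_const.sub (Finset.measurable_sum _ fun i hi => ?_)
  have : i - 1 ≤ j := by have := (Finset.mem_Icc.1 hi).2; omega
  exact (stronglyMeasurable_condExp.mono (ℱ.mono this)).measurable

lemma remainingCov_sub_succ (k : ℕ) (ω : Ω) :
    remainingCov μ ℱ Y k ω - remainingCov μ ℱ Y (k + 1) ω = condSecondMoment μ ℱ Y (k + 1) ω := by
  simp only [remainingCov, Finset.sum_Icc_succ_top (Nat.le_add_left 1 k)]
  abel

variable [IsProbabilityMeasure μ]

/-- Almost surely, `remainingCov k` is `P_{k+1}` and lies between `0` and `1`. -/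
lemma ae_remainingCov (hY2 : ∀ k ∈ Finset.Icc 1 n, MemLp (Y k) 2 μ)
    (hW : ∀ k ∈ Finset.Icc 1 n, IsCondSecondMoment (ℱ (k - 1)) (W k) (Y k) μ)
    (hP : ∀ᵐ ω ∂μ, partialCov n W 1 ω = 1) :
    ∀ᵐ ω ∂μ, ∀ k ≤ n, remainingCov μ ℱ Y k ω = partialCov n W (k + 1) ω ∧
      (remainingCov μ ℱ Y k ω).PosSemidef ∧ (1 - remainingCov μ ℱ Y k ω).PosSemidef := by
  have h1 : ∀ᵐ ω ∂μ, ∀ k ∈ Finset.Icc 1 n, W k ω = condSecondMoment μ ℱ Y k ω := by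
    rw [Finset.eventually_all]
    intro k hk
    have : ∀ᵐ ω ∂μ, ∀ i j, W k ω i j = condSecondMoment μ ℱ Y k ω i j := by
      simp only [ae_all_iff]
      exact fun i j => hW k hk i j
    filter_upwards [this] with ω hω
    exact Matrix.ext hω
  have h2 : ∀ᵐ ω ∂μ, ∀ k ∈ Finset.Icc 1 n, (W k ω).PosSemidef := by
    rw [Finset.eventually_all]
    exact fun k hk => IsCondSecondMoment.ae_posSemidef (ℱ.le _) (hY2 k hk) (hW k hk)
  filter_upwards [h1, h2, hP] with ω h1 h2 hP k hk
  have hsub : Finset.Icc 1 k ⊆ Finset.Icc 1 n := Finset.Icc_subset_Icc le_rfl hk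
  have e1 : remainingCov μ ℱ Y k ω = 1 - ∑ i ∈ Finset.Icc 1 k, W i ω := by
    rw [remainingCov, Finset.sum_congr rfl fun i hi => (h1 i (hsub hi)).symm]
  have e2 : ∑ i ∈ Finset.Icc 1 k, W i ω + partialCov n W (k + 1) ω = 1 := by
    rw [← hP, partialCov, partialCov]
    have := Finset.sum_Ioc_consecutive (fun i => W i ω) (Nat.zero_le k) hk
    simpa only [← Finset.Icc_add_one_left_eq_Ioc, zero_add] using this
  have e3 : remainingCov μ ℱ Y k ω = partialCov n W (k + 1) ω := by
    rw [e1, ← e2]; abel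
  refine ⟨e3, ?_, ?_⟩
  · rw [e3]
    exact Matrix.posSemidef_sum _ fun i hi => h2 i (Finset.Icc_subset_Icc (by omega) le_rfl hi)
  · rw [e1, sub_sub_cancel]
    exact Matrix.posSemidef_sum _ fun i hi => h2 i (hsub hi)

/-- The bound for a martingale whose total conditional covariance is the identity. The quantity
`T k` is the mean of `h` when the differences after time `k` are replaced by a Gaussian vector with
the remaining conditional covariance. For `M = 0` the right-hand side need not control singular
covariances, because of `0 * ∞ = 0`; hence `M ≠ 0`. -/
theorem ofReal_abs_integral_partialSum_sub_le (hh : Differentiable ℝ h)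
    (hd : Differentiable ℝ (gradient h)) (hG : LipschitzWith M (gradient h)) (hM : M ≠ 0)
    (hY : IsMartingaleDifference n Y ℱ μ) (hY2 : ∀ k ∈ Finset.Icc 1 n, MemLp (Y k) 2 μ)
    (hW : ∀ k ∈ Finset.Icc 1 n, IsCondSecondMoment (ℱ (k - 1)) (W k) (Y k) μ)
    (hP : ∀ᵐ ω ∂μ, partialCov n W 1 ω = 1) :
    ENNReal.ofReal |∫ ω, h (partialSum n Y ω) ∂μ - ∫ z, h z ∂(stdGaussian _)| ≤
      ENNReal.ofReal (3 * Real.pi / 8) * M * ∑ k ∈ Finset.Icc 1 n,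
        ∫⁻ ω, relInvNorm 1 (partialCov n W k ω) ^ (1 / 2 : ℝ)
          * ENNReal.ofReal (‖Y k ω‖ ^ 3) ∂μ := by
  have hR := ae_remainingCov hY2 hW hP
  have hRk : ∀ k ≤ n, ∀ᵐ ω ∂μ, remainingCov μ ℱ Y k ω = partialCov n W (k + 1) ω ∧
      (remainingCov μ ℱ Y k ω).PosSemidef ∧ (1 - remainingCov μ ℱ Y k ω).PosSemidef := fun k hk => by
    filter_upwards [hR] with ω hω using hω k hk
  set R := remainingCov μ ℱ Y
  have hRm : ∀ k, Measurable (R k) := fun k =>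
    (measurable_remainingCov (Nat.le_succ k)).mono (ℱ.le k) le_rfl
  set T : ℕ → ℝ := fun k => ∫ ω, gaussSmooth h (partialSum k Y ω) (R k ω) ∂μ
  have hTi : ∀ k ≤ n, Integrable (fun ω => gaussSmooth h (partialSum k Y ω) (R k ω)) μ :=
    fun k hk => integrable_gaussSmooth hh hG (memLp_partialSum hY2 hk) (hRm k).aemeasurable
      ((hRk k hk).mono fun ω hω => hω.2)
  have hstep : ∀ k < n, ENNReal.ofReal |T (k + 1) - T k| ≤ ENNReal.ofReal (3 * Real.pi / 8) * M *
      ∫⁻ ω, relInvNorm 1 (partialCov n W (k + 1) ω) ^ (1 / 2 : ℝ)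
          * ENNReal.ofReal (‖Y (k + 1) ω‖ ^ 3) ∂μ := by
    intro k hk
    have hk1 : k + 1 ∈ Finset.Icc 1 n := Finset.mem_Icc.2 ⟨by omega, hk⟩
    have e1 : T (k + 1) = ∫ ω, gaussSmooth h (partialSum k Y ω + Y (k + 1) ω) (R (k + 1) ω) ∂μ := by
      simp only [T, partialSum_succ]
    have hi1 := hTi (k + 1) hk
    simp only [partialSum_succ] at hi1
    have e2 : ∫⁻ ω, relInvNorm 1 (partialCov n W (k + 1) ω) ^ (1 / 2 : ℝ)
          * ENNReal.ofReal (‖Y (k + 1) ω‖ ^ 3) ∂μ =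
        ∫⁻ ω, relInvNorm 1 (R k ω) ^ (1 / 2 : ℝ) * ENNReal.ofReal (‖Y (k + 1) ω‖ ^ 3) ∂μ := by
      refine lintegral_congr_ae ?_
      filter_upwards [hRk k hk.le] with ω hω
      rw [hω.1]
    rw [e1, e2]
    refine ofReal_abs_integral_gaussSmooth_sub_le_of_condExp hh hd hG hM (ℱ.le k)
      (hY2 _ hk1) (hY.condExp_eq_zero _ hk1) (measurable_partialSum hY hk.le)
      (measurable_remainingCov (Nat.le_succ k)) (measurable_remainingCov le_rfl)
      ((hRk k hk.le).mono fun ω hω => hω.2.1) ((hRk (k + 1) hk).mono fun ω hω => hω.2.1) ?_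
      hi1 (hTi k hk.le)
    simp only [R, remainingCov_sub_succ]
    exact isCondSecondMoment_condSecondMoment (k + 1)
  have hT0 : T 0 = ∫ z, h z ∂(stdGaussian _) := by
    simp [T, R, partialSum, remainingCov, gaussSmooth_one]
  have hTn : T n = ∫ ω, h (partialSum n Y ω) ∂μ := by
    refine integral_congr_ae ?_
    filter_upwards [hRk n le_rfl] with ω hω
    simp [hω.1, partialCov, gaussSmooth_zero]
  rw [← hT0, ← hTn]
  exact ofReal_abs_sub_le_sum T (fun k => ∫⁻ ω, relInvNorm 1 (partialCov n W k ω) ^ (1 / 2 : ℝ)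
    * ENNReal.ofReal (‖Y k ω‖ ^ 3) ∂μ) _ n hstep

/-- If `∇h` is constant, then `h` is affine and both expectations agree. -/
lemma integral_partialSum_eq_of_lipschitz_zero (hh : Differentiable ℝ h)
    (hG : LipschitzWith 0 (gradient h)) (hY : IsMartingaleDifference n Y ℱ μ) :
    ∫ ω, h (partialSum n Y ω) ∂μ = ∫ z, h z ∂(stdGaussian _) := by
  have hg : ∀ x, gradient h x = gradient h 0 := fun x => by
    have := hG.norm_sub_le x 0
    simpa [sub_eq_zero] using this
  have haff : ∀ x, h x = h 0 + inner ℝ (gradient h 0) x := by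
    intro x
    have hd : ∀ x, HasFDerivAt (fun x => h x - inner ℝ (gradient h 0) x)
        (0 : EuclideanSpace ℝ (Fin d) →L[ℝ] ℝ) x := fun x => by
      have h1 := (hh x).hasGradientAt.hasFDerivAt
      rw [hg] at h1
      have h2 := h1.fun_sub (innerSL ℝ (gradient h 0)).hasFDerivAt
      refine h2.congr_fderiv ?_
      ext y; simp
    have := is_const_of_fderiv_eq_zero (𝕜 := ℝ) (fun x => (hd x).differentiableAt)
      (fun x => (hd x).fderiv) x 0
    simp only [inner_zero_right, sub_zero] at this
    linarith
  have hi : Integrable (partialSum n Y) μ := integrable_finsetSum _ fun i hi => hY.integrable i hi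
  have e1 : ∫ ω, h (partialSum n Y ω) ∂μ = h 0 := by
    simp only [haff (partialSum n Y _)]
    rw [integral_add (integrable_const _) (hi.const_inner _), integral_inner hi,
      integral_partialSum_eq_zero hY]
    simp
  have hid : Integrable (fun z : EuclideanSpace ℝ (Fin d) => z) (stdGaussian _) :=
    IsGaussian.integrable_id
  have e2 : ∫ z, h z ∂(stdGaussian (EuclideanSpace ℝ (Fin d))) = h 0 := by
    rw [integral_congr_ae (.of_forall haff),
      integral_add (integrable_const _) (hid.const_inner _), integral_inner hid,
      integral_id_stdGaussian]
    simp
  rw [e1, e2]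

/-- The sum of the error terms vanishes only if all differences vanish, which is impossible when the
covariance is the identity matrix of positive size. -/
lemma sum_lintegral_ne_zero (hd : d ≠ 0)
    (hY2 : ∀ k ∈ Finset.Icc 1 n, MemLp (Y k) 2 μ)
    (hW : ∀ k ∈ Finset.Icc 1 n, IsCondSecondMoment (ℱ (k - 1)) (W k) (Y k) μ)
    (hP : ∀ᵐ ω ∂μ, partialCov n W 1 ω = 1) :
    ∑ k ∈ Finset.Icc 1 n, ∫⁻ ω, relInvNorm 1 (partialCov n W k ω) ^ (1 / 2 : ℝ)
      * ENNReal.ofReal (‖Y k ω‖ ^ 3) ∂μ ≠ 0 := by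
  intro h0
  rw [Finset.sum_eq_zero_iff] at h0
  have hWm : ∀ k ∈ Finset.Icc 1 n, ∀ i j, AEMeasurable (fun ω => W k ω i j) μ := fun k hk i j =>
    ((stronglyMeasurable_condExp.mono (ℱ.le _)).measurable.aemeasurable).congr (hW k hk i j).symm
  have hPm : ∀ k ∈ Finset.Icc 1 n, AEMeasurable (partialCov n W k) μ := fun k hk => by
    refine aemeasurable_pi_iff.2 fun i => aemeasurable_pi_iff.2 fun j => ?_
    have e : (fun ω => partialCov n W k ω i j) = fun ω => ∑ l ∈ Finset.Icc k n, W l ω i j := by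
      ext ω; simp [partialCov, Matrix.sum_apply]
    rw [e]
    exact Finset.aemeasurable_fun_sum _ fun l hl =>
      hWm l (Finset.Icc_subset_Icc (Finset.mem_Icc.1 hk).1 le_rfl hl) i j
  have hY0 : ∀ k ∈ Finset.Icc 1 n, Y k =ᵐ[μ] 0 := fun k hk => by
    have hYm : AEMeasurable (Y k) μ := (hY2 k hk).1.aemeasurable
    have h1 := h0 k hk
    have hm : AEMeasurable (fun ω => relInvNorm 1 (partialCov n W k ω) ^ (1 / 2 : ℝ) *
        ENNReal.ofReal (‖Y k ω‖ ^ 3)) μ :=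
      (((measurable_relInvNorm 1).comp_aemeasurable (hPm k hk)).pow_const _).mul (by fun_prop)
    rw [lintegral_eq_zero_iff' hm] at h1
    filter_upwards [h1] with ω hω
    rw [Pi.zero_apply, mul_eq_zero, ENNReal.rpow_eq_zero_iff] at hω
    have := relInvNorm_one_ne_zero hd (partialCov n W k ω)
    rcases hω with hω | hω
    · norm_num [this] at hω
    · simpa using hω
  have hW0 : ∀ᵐ ω ∂μ, ∀ k ∈ Finset.Icc 1 n, W k ω = 0 := by
    rw [Finset.eventually_all]
    intro k hk
    have : ∀ᵐ ω ∂μ, ∀ i j, W k ω i j = 0 := by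
      simp only [ae_all_iff]
      intro i j
      have e : (fun ω => Y k ω i * Y k ω j) =ᵐ[μ] 0 := by
        filter_upwards [hY0 k hk] with ω hω; simp [hω]
      have h1 := (hW k hk i j).trans (condExp_congr_ae e)
      rw [condExp_zero] at h1
      exact h1
    filter_upwards [this] with ω hω
    exact Matrix.ext hω
  obtain ⟨ω, h1, h2⟩ := (hW0.and hP).exists
  rw [partialCov, Finset.sum_eq_zero h1] at h2
  have : Nonempty (Fin d) := ⟨⟨0, Nat.pos_of_ne_zero hd⟩⟩
  exact zero_ne_one h2

end Telescoping

/-! ### Normalization by the inverse square root of the covariance -/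

section Normalization

open scoped NNReal

variable {d : ℕ}

lemma lipschitzWith_gradient {h : EuclideanSpace ℝ (Fin d) → ℝ} (hM : M₂ h ≠ ∞) :
    LipschitzWith (M₂ h).toNNReal (gradient h) := by
  refine LipschitzWith.of_dist_le_mul fun x y => ?_
  by_cases hxy : x = y
  · simp [hxy]
  have h1 : ENNReal.ofReal (‖gradient h x - gradient h y‖ / ‖x - y‖) ≤ M₂ h :=
    le_iSup_of_le x (le_iSup_of_le y (le_iSup_of_le hxy le_rfl))
  have h2 := ENNReal.toReal_mono hM h1
  rw [ENNReal.toReal_ofReal (by positivity),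
    div_le_iff₀ (norm_pos_iff.2 (sub_ne_zero.2 hxy))] at h2
  rwa [dist_eq_norm, dist_eq_norm]

lemma M₂_eq_zero_of_dim_zero (hd : d = 0) (h : EuclideanSpace ℝ (Fin d) → ℝ) : M₂ h = 0 := by
  subst hd
  simp only [M₂, ENNReal.iSup_eq_zero]
  exact fun x y hxy => absurd (Subsingleton.elim x y) hxy

variable {Ω : Type*} {mΩ : MeasurableSpace Ω} {μ : Measure Ω}

/-- Linear images of a martingale difference sequence. -/
lemma IsMartingaleDifference.clm_comp {n : ℕ} {ℱ : Filtration ℕ mΩ}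
    {X : ℕ → Ω → EuclideanSpace ℝ (Fin d)} (hX : IsMartingaleDifference n X ℱ μ)
    (T : EuclideanSpace ℝ (Fin d) →L[ℝ] EuclideanSpace ℝ (Fin d)) :
    IsMartingaleDifference n (fun k ω => T (X k ω)) ℱ μ where
  adapted k hk := T.continuous.comp_stronglyMeasurable (hX.adapted k hk)
  integrable k hk := T.integrable_comp (hX.integrable k hk)
  condExp_eq_zero k hk := by
    have h1 := T.comp_condExp_comm (hX.integrable k hk) (m := ℱ (k - 1))
    refine (Filter.EventuallyEq.symm h1).trans ?_
    filter_upwards [hX.condExp_eq_zero k hk] with ω hω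
    simp [hω]

/-- Linear images transform conditional second moments by congruence. -/
lemma IsCondSecondMoment.mulVec {𝒢 : MeasurableSpace Ω}
    {V : Ω → Matrix (Fin d) (Fin d) ℝ} {X : Ω → EuclideanSpace ℝ (Fin d)}
    (hV : IsCondSecondMoment 𝒢 V X μ) (hX : MemLp X 2 μ) (L : Matrix (Fin d) (Fin d) ℝ) :
    IsCondSecondMoment 𝒢 (fun ω => L * V ω * L.transpose)
      (fun ω => Matrix.toEuclideanCLM (𝕜 := ℝ) L (X ω)) μ := by
  intro i j
  have hi : ∀ a b, Integrable (fun ω => X ω a * X ω b) μ := integrable_mul_apply_of_memLp hX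
  have e1 : (fun ω => Matrix.toEuclideanCLM (𝕜 := ℝ) L (X ω) i *
      Matrix.toEuclideanCLM (𝕜 := ℝ) L (X ω) j) =
      ∑ a, ∑ b, (L i a * L j b) • fun ω => X ω a * X ω b := by
    ext ω
    simp only [Matrix.ofLp_toEuclideanCLM, Matrix.mulVec, dotProduct, Finset.sum_mul_sum,
      Finset.sum_apply, Pi.smul_apply, smul_eq_mul]
    exact Finset.sum_congr rfl fun a _ => Finset.sum_congr rfl fun b _ => by ring
  have e2 : μ[fun ω => Matrix.toEuclideanCLM (𝕜 := ℝ) L (X ω) i *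
      Matrix.toEuclideanCLM (𝕜 := ℝ) L (X ω) j | 𝒢] =ᵐ[μ]
      ∑ a, ∑ b, (L i a * L j b) • μ[fun ω => X ω a * X ω b | 𝒢] := by
    rw [e1]
    refine (condExp_finsetSum (fun a _ => integrable_finsetSum' _ fun b _ => (hi a b).smul _)
      𝒢).trans ?_
    refine eventuallyEq_sum fun a _ => ?_
    refine (condExp_finsetSum (fun b _ => (hi a b).smul _) 𝒢).trans ?_
    exact eventuallyEq_sum fun b _ => condExp_smul _ _ _
  refine Filter.EventuallyEq.trans ?_ e2.symm
  have hV' : ∀ᵐ ω ∂μ, ∀ a b, V ω a b = (μ[fun ω => X ω a * X ω b | 𝒢]) ω := by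
    simp only [ae_all_iff]
    exact fun a b => hV a b
  filter_upwards [hV'] with ω hω
  simp only [Matrix.mul_apply, Matrix.transpose_apply, Finset.sum_mul, Finset.sum_apply,
    Pi.smul_apply, smul_eq_mul, hω]
  rw [Finset.sum_comm]
  exact Finset.sum_congr rfl fun a _ => Finset.sum_congr rfl fun b _ => by ring

lemma transpose_inv_sqrt (S : Matrix (Fin d) (Fin d) ℝ) :
    ((CFC.sqrt S)⁻¹).transpose = (CFC.sqrt S)⁻¹ := by
  have h1 : (CFC.sqrt S).IsHermitian :=
    Matrix.isHermitian_iff_isSelfAdjoint.2 (CFC.sqrt_nonneg S).isSelfAdjoint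
  have := h1.inv.eq
  rwa [Matrix.conjTranspose_eq_transpose_of_trivial] at this

/-- `‖S^{1/2} P⁻¹ S^{1/2}‖` is the inverse norm of the normalized matrix `S^{-1/2} P S^{-1/2}`. -/
lemma relInvNorm_one_conj {S : Matrix (Fin d) (Fin d) ℝ} (hS : S.PosDef)
    (P : Matrix (Fin d) (Fin d) ℝ) :
    relInvNorm 1 ((CFC.sqrt S)⁻¹ * P * (CFC.sqrt S)⁻¹) = relInvNorm S P := by
  have hu := isUnit_det_sqrt hS.posSemidef hS.det_pos.ne'.isUnit
  have hiff : IsUnit ((CFC.sqrt S)⁻¹ * P * (CFC.sqrt S)⁻¹).det ↔ IsUnit P.det := by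
    have hu' := Matrix.isUnit_nonsing_inv_det _ hu
    rw [Matrix.det_mul, Matrix.det_mul, IsUnit.mul_iff, IsUnit.mul_iff]
    tauto
  by_cases hP : IsUnit P.det
  · rw [relInvNorm_one (hiff.2 hP), relInvNorm, if_pos hP, Matrix.mul_inv_rev, Matrix.mul_inv_rev,
      Matrix.nonsing_inv_nonsing_inv _ hu, mul_assoc]
  · rw [relInvNorm_of_not_isUnit _ hP, relInvNorm_of_not_isUnit _ (fun h => hP (hiff.1 h))]

end Normalization

end MartingaleCLT

open MartingaleCLT in
theorem theorem1 {Ω Ω' : Type*} {mΩ : MeasurableSpace Ω} {mΩ' : MeasurableSpace Ω'}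
    (μ : Measure Ω) [IsProbabilityMeasure μ] (μ' : Measure Ω') [IsProbabilityMeasure μ']
    (d n : ℕ)
    -- the martingale difference sequence, with finite second moments
    (ℱ : Filtration ℕ mΩ) (X : ℕ → Ω → EuclideanSpace ℝ (Fin d))
    (hX : MartingaleCLT.IsMartingaleDifference n X ℱ μ)
    (hX2 : ∀ k ∈ Finset.Icc 1 n, MemLp (X k) 2 μ)
    -- the conditional covariances
    (V : ℕ → Ω → Matrix (Fin d) (Fin d) ℝ)
    (hV : ∀ k ∈ Finset.Icc 1 n, MartingaleCLT.IsCondSecondMoment (ℱ (k - 1)) (V k) (X k) μ)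
    -- the variance of the sum, which is nonsingular
    (S : Matrix (Fin d) (Fin d) ℝ)
    (hS : S = MartingaleCLT.varMatrix (MartingaleCLT.partialSum n X) μ)
    (hSpos : S.PosDef)
    (hP : ∀ᵐ ω ∂μ, MartingaleCLT.partialCov n V 1 ω = S)
    -- the standard normal vector
    (Z : Ω' → EuclideanSpace ℝ (Fin d))
    (hZ : HasLaw Z (stdGaussian (EuclideanSpace ℝ (Fin d))) μ')
    -- the test function
    (h : EuclideanSpace ℝ (Fin d) → ℝ)
    (hh : Differentiable ℝ h) (hh' : Differentiable ℝ (gradient h)) :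
    (MartingaleCLT.M₂ h ≠ ∞ →
      Integrable (fun ω => h (MartingaleCLT.invSqrtMul S (MartingaleCLT.partialSum n X ω))) μ ∧
      Integrable (fun ω => h (Z ω)) μ') ∧
    ENNReal.ofReal
        |(∫ ω, h (MartingaleCLT.invSqrtMul S (MartingaleCLT.partialSum n X ω)) ∂μ)
          - ∫ ω, h (Z ω) ∂μ'|
      ≤ ENNReal.ofReal (3 * Real.pi / 8 * Real.sqrt d) * MartingaleCLT.M₂ h *
        ∑ k ∈ Finset.Icc 1 n,
          ∫⁻ ω, MartingaleCLT.relInvNorm S (MartingaleCLT.partialCov n V k ω) ^ (1 / 2 : ℝ)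
            * ENNReal.ofReal (‖MartingaleCLT.invSqrtMul S (X k ω)‖ ^ 3) ∂μ := by
  set L : Matrix (Fin d) (Fin d) ℝ := (CFC.sqrt S)⁻¹ with hL
  set Y : ℕ → Ω → EuclideanSpace ℝ (Fin d) := fun k ω => invSqrtMul S (X k ω)
  set W : ℕ → Ω → Matrix (Fin d) (Fin d) ℝ := fun k ω => L * V k ω * L
  have hY : IsMartingaleDifference n Y ℱ μ := hX.clm_comp (Matrix.toEuclideanCLM (𝕜 := ℝ) L)
  have hY2 : ∀ k ∈ Finset.Icc 1 n, MemLp (Y k) 2 μ := fun k hk =>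
    (Matrix.toEuclideanCLM (𝕜 := ℝ) L).comp_memLp' (hX2 k hk)
  have hW : ∀ k ∈ Finset.Icc 1 n, IsCondSecondMoment (ℱ (k - 1)) (W k) (Y k) μ := fun k hk => by
    have := (hV k hk).mulVec (hX2 k hk) L
    rwa [hL, transpose_inv_sqrt, ← hL] at this
  have hcov : ∀ k ω, partialCov n W k ω = L * partialCov n V k ω * L := fun k ω => by
    simp only [partialCov, W, Finset.mul_sum, Finset.sum_mul]
  have hPW : ∀ᵐ ω ∂μ, partialCov n W 1 ω = 1 := by
    filter_upwards [hP] with ω hω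
    rw [hcov, hω]
    conv_lhs => rw [← CFC.sqrt_mul_sqrt_self S hSpos.posSemidef.nonneg]
    have hu := isUnit_det_sqrt hSpos.posSemidef hSpos.det_pos.ne'.isUnit
    rw [← mul_assoc, hL, Matrix.nonsing_inv_mul _ hu, one_mul, Matrix.mul_nonsing_inv _ hu]
  have hsum : ∀ ω, invSqrtMul S (partialSum n X ω) = partialSum n Y ω := fun ω => by
    simp only [partialSum, invSqrtMul, Y, map_sum]
  have hrel : ∀ k ω, relInvNorm S (partialCov n V k ω) = relInvNorm 1 (partialCov n W k ω) :=
    fun k ω => by rw [hcov, relInvNorm_one_conj hSpos]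
  have hZi : ∫ ω, h (Z ω) ∂μ' = ∫ z, h z ∂(stdGaussian (EuclideanSpace ℝ (Fin d))) :=
    hZ.integral_comp hh.continuous.aestronglyMeasurable
  simp only [hsum, hrel, hZi]
  refine ⟨fun hM => ⟨?_, ?_⟩, ?_⟩
  · -- the Gaussian mean with covariance `0` is the value of `h` itself
    have := integrable_gaussSmooth (P := fun _ => 0) hh (lipschitzWith_gradient hM)
      (memLp_partialSum hY2 le_rfl) aemeasurable_const
      (.of_forall fun _ => ⟨Matrix.PosSemidef.zero, by rw [sub_zero]; exact Matrix.PosSemidef.one⟩)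
    simpa only [gaussSmooth_zero] using this
  · have := integrable_stdGaussian_of_lipschitz_gradient hh (lipschitzWith_gradient hM)
    rw [← hZ.map_eq] at this
    exact this.comp_aemeasurable hZ.aemeasurable
  -- `M₂ h = 0` covers the case `d = 0`, in which `√d = 0`
  by_cases hM0 : M₂ h = 0
  · have hG := lipschitzWith_gradient (h := h) (by rw [hM0]; exact ENNReal.zero_ne_top)
    rw [hM0, ENNReal.toNNReal_zero] at hG
    simp [integral_partialSum_eq_of_lipschitz_zero hh hG hY]
  have hd : d ≠ 0 := fun hd => hM0 (M₂_eq_zero_of_dim_zero hd h)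
  have hd1 : 1 ≤ Real.sqrt d := by
    rw [Real.one_le_sqrt]
    exact_mod_cast Nat.one_le_iff_ne_zero.2 hd
  have hc : 3 * Real.pi / 8 ≤ 3 * Real.pi / 8 * Real.sqrt d :=
    le_mul_of_one_le_right (by positivity) hd1
  by_cases hM : M₂ h = ∞
  · have h1 : ENNReal.ofReal (3 * Real.pi / 8 * Real.sqrt d) ≠ 0 :=
      ENNReal.ofReal_ne_zero_iff.2 (lt_of_lt_of_le (by positivity) hc)
    rw [hM, ENNReal.mul_top h1, ENNReal.top_mul (sum_lintegral_ne_zero hd hY2 hW hPW)]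
    exact le_top
  · refine (ofReal_abs_integral_partialSum_sub_le hh hh' (lipschitzWith_gradient hM)
      (ENNReal.toNNReal_ne_zero.2 ⟨hM0, hM⟩) hY hY2 hW hPW).trans ?_
    rw [ENNReal.coe_toNNReal hM]
    gcongr
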